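/- Let $A$, $B$ be finite-dimensional nonzero complex Hilbert spaces and let $H=H_A\otimes H_B$ with $H_A$, $H_B$ Hermitian. Let $\Delta_A$ (resp. $\Delta_B$) be the difference between the largest and the smallest eigenvalue of $H_A$ (resp. $H_B$). For a normalized pure state $\psi$ of a bipartite system let $E(\psi)=-\operatorname{tr}\rho\log_2\rho$, where $\rho$ is the reduced density matrix of $\psi$ on Alice's system. For a Hermitian operator $H$ on a bipartite system let $$\Gamma_H=\sup_{\psi}\ \frac{d}{dt}\Big|_{t=0}E\big(e^{-iHt}\psi\big),$$ the supremum being over the normalized pure states $\psi$ of the system on which $H$ acts (no ancillas); this is the single-shot entanglement capability of $H$. Let $$\alpha=2\max_{x\in[0,1]}\sqrt{x(1-x)}\,\log_2\frac{x}{1-x}$$ (the function being $0$ at $x=0,1$). This maximum is attained, and the derivative above exists for every Hermitian $H$ and every $\psi$. Moreover: 1. The supremum defining $\Gamma_{H_A\otimes H_B}$ is attained, and $$\Gamma_{H_A\otimes H_B}=\frac{\alpha}{4}\Delta_A\Delta_B .$$ Ancillas do not help: for all finite-dimensional nonzero ancillas $A'$ (held by Alice) and $B'$ (held by Bob), the maximal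 rate of $H\otimes I_{A'B'}$ over the normalized pure states of $AA'BB'$ is the same number. 2. Let $x_0\in[0,1]$ be a point where the maximum defining $\alpha$ is attained. Let $|1\rangle_A$, $|d_A\rangle_A$ be orthonormal eigenvectors of $H_A$ for its largest and its smallest eigenvalue, let $|1\rangle_B$, $|d_B\rangle_B$ be the same for $H_B$, and put $|\pm\rangle_A=\frac1{\sqrt2}(|1\rangle_A\pm|d_A\rangle_A)$, and similarly $|\pm\rangle_B$. Then $$|\psi\rangle=\sqrt{x_0}\,|+\rangle_A\otimes|+\rangle_B-i\sqrt{1-x_0}\,|-\rangle_A\otimes|-\rangle_B$$ is a normalized state at which the rate $\Gamma_{H_A\otimes H_B}$ is attained. 3. If $H_1$ and $H_2$ are product Hamiltonians on bipartite systems $A_1B_1$ and $A_2B_2$, and $H_1\boxplus H_2=H_1\otimes I_{A_2B_2}+I_{A_1B_1}\otimes H_2$, with Alice holding $A_1A_2$ and Bob holding $B_1B_2$, then $$\Gamma_{H_1\boxplus H_2}=\Gamma_{H_1}+\Gamma_{H_2},$$ and the supremum defining $\Gamma_{H_1\boxplus H_2}$ is attained. -/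

import Mathlib

open scoped Kronecker Matrix

noncomputable section

namespace BipartiteEntanglement

/-- A vector of Euclidean norm one, i.e. a normalized pure state. -/
def IsNormalized {ι : Type*} [Fintype ι] (v : ι → ℂ) : Prop :=
  ∑ i, ‖v i‖ ^ 2 = 1

/-- The tensor product of a vector of Alice's and a vector of Bob's space. -/
def tensorVec {A B : Type*} (u : A → ℂ) (v : B → ℂ) : A × B → ℂ :=
  fun p => u p.1 * v p.2

/-- The reduced density matrix of system `A` for the pure state `ψ` of `AB`:
the partial trace over `B` of the projector onto `ψ`. -/
def reducedDensity {A B : Type*} [Fintype B] (ψ : A × B → ℂ) : Matrix A A ℂ :=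
  Matrix.of fun a a' => ∑ b, ψ (a, b) * star (ψ (a', b))

theorem reducedDensity_isHermitian {A B : Type*} [Fintype B] (ψ : A × B → ℂ) :
    (reducedDensity ψ).IsHermitian := by
  ext a a'
  simp [reducedDensity, Matrix.conjTranspose_apply, mul_comm]

/-- The von Neumann entropy, in bits, of a Hermitian matrix. The convention `0 log 0 = 0`
is built into `Real.logb`. -/
def vonNeumannEntropy {A : Type*} [Fintype A] [DecidableEq A] {ρ : Matrix A A ℂ}
    (hρ : ρ.IsHermitian) : ℝ :=
  -∑ i, hρ.eigenvalues i * Real.logb 2 (hρ.eigenvalues i)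

/-- The entropy of entanglement, in ebits, of a pure state of `AB`. -/
def entanglement {A B : Type*} [Fintype A] [DecidableEq A] [Fintype B]
    (ψ : A × B → ℂ) : ℝ :=
  vonNeumannEntropy (reducedDensity_isHermitian ψ)

/-- Schroedinger evolution `exp (-i H t) ψ`. -/
def evolve {ι : Type*} [Fintype ι] [DecidableEq ι] (H : Matrix ι ι ℂ) (t : ℝ) (ψ : ι → ℂ) :
    ι → ℂ :=
  (NormedSpace.exp ((-Complex.I * (t : ℂ)) • H)) *ᵥ ψ

/-- The instantaneous rate at `t = 0` at which `H` creates entanglement from `ψ`. -/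
def entanglementRate {A B : Type*} [Fintype A] [DecidableEq A] [Fintype B] [DecidableEq B]
    (H : Matrix (A × B) (A × B) ℂ) (ψ : A × B → ℂ) : ℝ :=
  deriv (fun t : ℝ => entanglement (evolve H t ψ)) 0

/-- All entanglement rates that `H` reaches on normalized pure states of `AB`. -/
def entanglementRates {A B : Type*} [Fintype A] [DecidableEq A] [Fintype B] [DecidableEq B]
    (H : Matrix (A × B) (A × B) ℂ) : Set ℝ :=
  {r | ∃ ψ : A × B → ℂ, IsNormalized ψ ∧ r = entanglementRate H ψ}

/-- The single-shot entanglement capability of `H`: the supremum of the entanglement rates over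
normalized pure states of the two interacting systems alone (no ancillas). -/
def entanglementCapability {A B : Type*} [Fintype A] [DecidableEq A] [Fintype B] [DecidableEq B]
    (H : Matrix (A × B) (A × B) ℂ) : ℝ :=
  sSup (entanglementRates H)

/-- The largest eigenvalue. -/
def maxEigenvalue {ι : Type*} [Fintype ι] [DecidableEq ι] {M : Matrix ι ι ℂ}
    (hM : M.IsHermitian) : ℝ :=
  ⨆ i, hM.eigenvalues i

/-- The smallest eigenvalue. -/
def minEigenvalue {ι : Type*} [Fintype ι] [DecidableEq ι] {M : Matrix ι ι ℂ}
    (hM : M.IsHermitian) : ℝ :=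
  ⨅ i, hM.eigenvalues i

/-- The difference of the largest and the smallest eigenvalue. -/
def spectralSpread {ι : Type*} [Fintype ι] [DecidableEq ι] {M : Matrix ι ι ℂ}
    (hM : M.IsHermitian) : ℝ :=
  maxEigenvalue hM - minEigenvalue hM

/-- The unit vector `e` spans an eigenline for the largest eigenvalue, the unit vector `f` one for
the smallest eigenvalue, and the two are orthogonal. -/
structure IsExtremalPair {ι : Type*} [Fintype ι] [DecidableEq ι] {M : Matrix ι ι ℂ}
    (hM : M.IsHermitian) (e f : ι → ℂ) : Prop where
  normalized_max : IsNormalized e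
  normalized_min : IsNormalized f
  orthogonal : ∑ i, star (e i) * f i = 0
  eigen_max : M *ᵥ e = (maxEigenvalue hM : ℂ) • e
  eigen_min : M *ᵥ f = (minEigenvalue hM : ℂ) • f

/-- `H₁ ⊞ H₂ = H₁ ⊗ 1 + 1 ⊗ H₂`, where Alice holds `A₁A₂` and Bob holds `B₁B₂`. -/
def boxSum {A₁ B₁ A₂ B₂ : Type*} [DecidableEq A₁] [DecidableEq B₁] [DecidableEq A₂]
    [DecidableEq B₂] (H₁ : Matrix (A₁ × B₁) (A₁ × B₁) ℂ) (H₂ : Matrix (A₂ × B₂) (A₂ × B₂) ℂ) :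
    Matrix ((A₁ × A₂) × (B₁ × B₂)) ((A₁ × A₂) × (B₁ × B₂)) ℂ :=
  (H₁ ⊗ₖ (1 : Matrix (A₂ × B₂) (A₂ × B₂) ℂ) +
      (1 : Matrix (A₁ × B₁) (A₁ × B₁) ℂ) ⊗ₖ H₂).submatrix
    (Equiv.prodProdProdComm A₁ A₂ B₁ B₂) (Equiv.prodProdProdComm A₁ A₂ B₁ B₂)

/-- `H ⊗ 1`, where Alice holds `A` and an ancilla `A'`, and Bob holds `B` and an ancilla `B'`. -/
def withAncillas {A B : Type*} (A' B' : Type*) [DecidableEq A'] [DecidableEq B']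
    (H : Matrix (A × B) (A × B) ℂ) :
    Matrix ((A × A') × (B × B')) ((A × A') × (B × B')) ℂ :=
  (H ⊗ₖ (1 : Matrix (A' × B') (A' × B') ℂ)).submatrix
    (Equiv.prodProdProdComm A A' B B') (Equiv.prodProdProdComm A A' B B')

/-- `2 √(x(1-x)) log₂(x/(1-x))`; at `x = 0` and `x = 1` the value is the limit `0`. -/
def isingRate (x : ℝ) : ℝ :=
  2 * (Real.sqrt (x * (1 - x)) * Real.logb 2 (x / (1 - x)))

/-- `α = 2 max_{x ∈ [0,1]} √(x(1-x)) log₂(x/(1-x))`. -/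
def alpha : ℝ :=
  sSup (isingRate '' Set.Icc 0 1)

/-- `(e + f)/√2`. -/
def plusVec {ι : Type*} (e f : ι → ℂ) : ι → ℂ :=
  ((1 / Real.sqrt 2 : ℝ) : ℂ) • (e + f)

/-- `(e - f)/√2`. -/
def minusVec {ι : Type*} (e f : ι → ℂ) : ι → ℂ :=
  ((1 / Real.sqrt 2 : ℝ) : ℂ) • (e - f)

/-- `√x |+⟩|+⟩ - i √(1-x) |-⟩|-⟩`, with `|±⟩` built from `e, f` for Alice and `e', f'` for Bob. -/
def optimalInput {A B : Type*} (x : ℝ) (e f : A → ℂ) (e' f' : B → ℂ) : A × B → ℂ :=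
  (Real.sqrt x : ℂ) • tensorVec (plusVec e f) (plusVec e' f') -
    (Complex.I * (Real.sqrt (1 - x) : ℂ)) • tensorVec (minusVec e f) (minusVec e' f')

end BipartiteEntanglement

end

noncomputable section

namespace BipartiteEntanglement

section

open Polynomial Filter Topology

/-! ### Polynomial approximation of `negMulLog` -/

/-! Write a state in Schmidt form with weights `l i`, and let `h i j` be the matrix element of the
Hamiltonian between the `i`-th and `j`-th Schmidt product vectors. The derivative of the entropy is
the sum of `-√(l i * l j) * (log₂ (l i) - log₂ (l j)) * Im (h i j)` over all `i, j`
(`hasDerivAt_entanglement`, `schmidtRate_eq_antisymm`).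

Upper bound: the definition of `alpha`, rescaled from weights `x, 1 - x` to arbitrary weights,
bounds each coefficient by `(l i + l j) * alpha / 2` (`abs_sqrt_mul_logb_sub_le`). For a product
Hamiltonian `h i j` factors. Off-diagonal elements do not change when a multiple of the identity is
subtracted, and centring the spectrum makes the operator norms half the spreads. Bessel and
Cauchy-Schwarz then bound every row sum of `|h i j|`, `j ≠ i`, by a quarter of the product of the
spreads (`sum_offDiagonal_mul_le`), and averaging with the weights `l i` gives the claimed value.
The bound uses only norms, so tensoring with identities does not change it; as the rate is linear in
the Hamiltonian, it also covers sums. A two-term Schmidt state attains it, and product states make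
the rates add. Ancillas are the case of a sum with zero second Hamiltonian.

Differentiability is delicate because eigenvalues may cross and `x log x` is not differentiable at
`0`. The entropy is compared with the trace of a polynomial `q` that interpolates `Real.negMulLog`
on the initial spectrum. A second polynomial `g ≥ 0`, vanishing on that spectrum, controls the
error: the trace of `g` is `O(t²)`, being smooth, nonnegative and zero at `t = 0`, while the
interpolation error is at most `ε √g + C g` for every `ε > 0`, hence `o(t)` after summation. -/

theorem exists_hermite_interpolation (s : Finset ℝ) (f g : ℝ → ℝ) :
    ∃ q : ℝ[X], ∀ c ∈ s, q.eval c = f c ∧ (derivative q).eval c = g c := by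
  classical
  have hinj : Set.InjOn (id : ℝ → ℝ) s := Function.injective_id.injOn
  set L := Lagrange.interpolate s id f with hL
  set N := Lagrange.nodal s (id : ℝ → ℝ) with hN
  set M := Lagrange.interpolate s id
    (fun c => (g c - (derivative L).eval c) / (derivative N).eval c) with hM
  -- The nodes are simple zeros of the nodal polynomial, so adding `N * M` keeps the values of `L`
  -- and adjusts its derivatives by `N' * M`.
  have hN0 : ∀ c ∈ s, (derivative N).eval c ≠ 0 := fun c hc => by
    have h1 := Lagrange.nodalWeight_ne_zero hinj hc
    rw [Lagrange.nodalWeight_eq_eval_derivative_nodal hc] at h1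
    exact fun h => h1 (by simp only [id] at *; rw [← hN, h, inv_zero])
  refine ⟨L + N * M, fun c hc => ?_⟩
  have hLc : L.eval c = f c := Lagrange.eval_interpolate_at_node f hinj hc
  have hMc : M.eval c = (g c - (derivative L).eval c) / (derivative N).eval c :=
    Lagrange.eval_interpolate_at_node _ hinj hc
  have hNc : N.eval c = 0 := Lagrange.eval_nodal_at_node (v := id) hc
  refine ⟨by simp [hLc, hNc], ?_⟩
  have := hN0 c hc
  simp only [derivative_add, derivative_mul, eval_add, eval_mul, hNc, hMc]
  field_simp
  ring

/-- A polynomial, nonnegative on `[0, ∞)`, vanishing exactly on `insert 0 s`, to second order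
away from `0`. -/
def gaugePolynomial (s : Finset ℝ) : ℝ[X] :=
  X * ∏ c ∈ s.erase 0, (X - C c) ^ 2

theorem eval_gaugePolynomial (s : Finset ℝ) (x : ℝ) :
    (gaugePolynomial s).eval x = x * ∏ c ∈ s.erase 0, (x - c) ^ 2 := by
  simp [gaugePolynomial, eval_prod]

theorem gaugePolynomial_nonneg (s : Finset ℝ) {x : ℝ} (hx : 0 ≤ x) :
    0 ≤ (gaugePolynomial s).eval x := by
  rw [eval_gaugePolynomial]; positivity

theorem gaugePolynomial_eq_zero {s : Finset ℝ} {x : ℝ} (hx : x ∈ s) :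
    (gaugePolynomial s).eval x = 0 := by
  rw [eval_gaugePolynomial]
  by_cases h : x = 0
  · simp [h]
  · rw [Finset.prod_eq_zero (Finset.mem_erase.2 ⟨h, hx⟩) (by simp), mul_zero]

theorem gaugePolynomial_pos {s : Finset ℝ} {x : ℝ} (h0 : 0 < x) (hx : x ∉ s) :
    0 < (gaugePolynomial s).eval x := by
  rw [eval_gaugePolynomial]
  refine mul_pos h0 (Finset.prod_pos fun c hc => ?_)
  have : x - c ≠ 0 := fun h => hx (by
    rw [sub_eq_zero.1 h]; exact (Finset.mem_erase.1 hc).2)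
  positivity

theorem gaugePolynomial_factor {s : Finset ℝ} {c : ℝ} (hc : c ∈ s) (hc0 : 0 < c) :
    ∃ p : ℝ[X], 0 < p.eval c ∧ ∀ x, (gaugePolynomial s).eval x = (x - c) ^ 2 * p.eval x := by
  classical
  refine ⟨X * ∏ d ∈ (s.erase 0).erase c, (X - C d) ^ 2, ?_, fun x => ?_⟩
  · simp only [eval_mul, eval_X, eval_prod, eval_pow, eval_sub, eval_C]
    refine mul_pos hc0 (Finset.prod_pos fun d hd => ?_)
    have : c - d ≠ 0 := sub_ne_zero.2 (Finset.mem_erase.1 hd).1.symm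
    positivity
  · simp only [eval_gaugePolynomial, eval_mul, eval_X, eval_prod, eval_pow, eval_sub, eval_C]
    rw [← Finset.mul_prod_erase _ _ (Finset.mem_erase.2 ⟨hc0.ne', hc⟩)]
    ring

theorem gaugePolynomial_factor_zero (s : Finset ℝ) :
    ∃ p : ℝ[X], 0 < p.eval 0 ∧ ∀ x, (gaugePolynomial s).eval x = x * p.eval x := by
  refine ⟨∏ c ∈ s.erase 0, (X - C c) ^ 2, ?_, fun x => ?_⟩
  · simp only [eval_prod, eval_pow, eval_sub, eval_C, eval_X]
    refine Finset.prod_pos fun d hd => ?_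
    have : 0 - d ≠ 0 := sub_ne_zero.2 (Finset.mem_erase.1 hd).1.symm
    positivity
  · simp [eval_gaugePolynomial, eval_prod]

/-- This is `x log x = o(√x)`. It is why a simple zero of the gauge polynomial at `0` is right: a
double zero would require the false estimate `x log x = O(x)`. -/
theorem eventually_abs_negMulLog_le {δ : ℝ} (hδ : 0 < δ) :
    ∀ᶠ x in 𝓝[≥] (0 : ℝ), |Real.negMulLog x| ≤ δ * √x := by
  have h1 : Tendsto (fun x : ℝ => 2 * Real.negMulLog (√x)) (𝓝 0) (𝓝 0) := by
    have : Continuous fun x : ℝ => 2 * Real.negMulLog (√x) := by fun_prop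
    simpa using this.tendsto 0
  have h2 := (h1.eventually (Metric.ball_mem_nhds 0 hδ)).filter_mono
    (nhdsWithin_le_nhds (s := Set.Ici 0))
  filter_upwards [h2, self_mem_nhdsWithin] with x hx hx0
  have hx0 : 0 ≤ x := hx0
  have : Real.negMulLog x = √x * (2 * Real.negMulLog (√x)) := by
    simp only [Real.negMulLog, Real.log_sqrt hx0]
    nth_rewrite 1 [← Real.mul_self_sqrt hx0]
    ring
  rw [this, abs_mul, abs_of_nonneg (Real.sqrt_nonneg x), mul_comm]
  refine mul_le_mul_of_nonneg_right ?_ (Real.sqrt_nonneg x)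
  have hx : dist (2 * Real.negMulLog (√x)) 0 < δ := hx
  rw [Real.dist_eq, sub_zero] at hx
  exact hx.le

/-- Near `0` the root of the gauge is comparable to `√x`, which dominates both `x log x` and `q`.
Near a positive node it is comparable to the distance from the node, and the error vanishes there to
first order. Elsewhere the gauge is bounded below, and a large `C` suffices. -/
theorem exists_negMulLog_approx_local {s : Finset ℝ} (h0 : 0 ∈ s) {q : ℝ[X]}
    (hq : ∀ c ∈ s, q.eval c = Real.negMulLog c)
    (hq' : ∀ c ∈ s, c ≠ 0 → (derivative q).eval c = -Real.log c - 1)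
    {ε : ℝ} (hε : 0 < ε) {x₀ : ℝ} (hx₀ : 0 ≤ x₀) :
    ∃ C : ℝ, 0 ≤ C ∧ ∀ᶠ x in 𝓝[Set.Ici 0] x₀, |Real.negMulLog x - q.eval x| ≤
        ε * √((gaugePolynomial s).eval x) + C * (gaugePolynomial s).eval x := by
  have hnn : ∀ᶠ x in 𝓝[Set.Ici 0] x₀, (0 : ℝ) ≤ x := self_mem_nhdsWithin
  by_cases hx₀s : x₀ ∈ s
  · refine ⟨0, le_rfl, ?_⟩
    simp only [zero_mul, add_zero]
    rcases hx₀.eq_or_lt with rfl | hpos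
    · obtain ⟨p, hp0, hp⟩ := gaugePolynomial_factor_zero s
      obtain ⟨m, hm0, hm⟩ := exists_between hp0
      obtain ⟨q₁, rfl⟩ : X ∣ q := by
        rw [X_dvd_iff, coeff_zero_eq_eval_zero, hq 0 h0, Real.negMulLog_zero]
      have hδ : 0 < ε * √m / 2 := by positivity
      have h2 : ∀ᶠ x in 𝓝 (0 : ℝ), |√x * q₁.eval x| < ε * √m / 2 := by
        have hc : Continuous fun x : ℝ => |√x * q₁.eval x| := by fun_prop
        have := hc.tendsto 0
        simp only [Real.sqrt_zero, zero_mul, abs_zero] at this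
        exact this.eventually (gt_mem_nhds hδ)
      have h3 : ∀ᶠ x in 𝓝 (0 : ℝ), m < p.eval x :=
        (p.continuous.tendsto 0).eventually (lt_mem_nhds hm)
      filter_upwards [hnn, eventually_abs_negMulLog_le hδ, h2.filter_mono nhdsWithin_le_nhds,
        h3.filter_mono nhdsWithin_le_nhds] with x hx h1 h2 h3
      rw [hp, Real.sqrt_mul hx, eval_mul, eval_X]
      have h4 : |x * q₁.eval x| ≤ ε * √m / 2 * √x := by
        calc |x * q₁.eval x| = |√x * q₁.eval x| * √x := by
              nth_rewrite 1 [← Real.mul_self_sqrt hx]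
              rw [mul_assoc, abs_mul, abs_of_nonneg (Real.sqrt_nonneg x), mul_comm]
          _ ≤ _ := mul_le_mul_of_nonneg_right h2.le (Real.sqrt_nonneg x)
      have h5 : √m ≤ √(p.eval x) := Real.sqrt_le_sqrt h3.le
      calc |Real.negMulLog x - x * q₁.eval x| ≤ |Real.negMulLog x| + |x * q₁.eval x| := abs_sub _ _
        _ ≤ ε * √m / 2 * √x + ε * √m / 2 * √x := add_le_add h1 h4
        _ = ε * (√x * √m) := by ring
        _ ≤ _ := by gcongr
    · obtain ⟨p, hp0, hp⟩ := gaugePolynomial_factor hx₀s hpos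
      obtain ⟨m, hm0, hm⟩ := exists_between hp0
      have hδ : 0 < ε * √m := by positivity
      have hd : HasDerivAt (fun x => Real.negMulLog x - q.eval x) 0 x₀ := by
        have := (Real.hasDerivAt_negMulLog hpos.ne').sub (q.hasDerivAt x₀)
        rwa [hq' x₀ hx₀s hpos.ne', sub_self] at this
      have h2 := hd.isLittleO.def hδ
      have h3 : ∀ᶠ x in 𝓝 x₀, m < p.eval x :=
        (p.continuous.tendsto x₀).eventually (lt_mem_nhds hm)
      filter_upwards [h2.filter_mono nhdsWithin_le_nhds, h3.filter_mono nhdsWithin_le_nhds]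
        with x h2 h3
      simp only [hq x₀ hx₀s, sub_self, sub_zero, smul_zero, Real.norm_eq_abs] at h2
      rw [hp, Real.sqrt_mul (sq_nonneg _), Real.sqrt_sq_eq_abs]
      have h5 : √m ≤ √(p.eval x) := Real.sqrt_le_sqrt h3.le
      calc _ ≤ ε * √m * |x - x₀| := h2
        _ = ε * (|x - x₀| * √m) := by ring
        _ ≤ _ := by gcongr
  · have hpos : 0 < x₀ := lt_of_le_of_ne hx₀ fun h => hx₀s (h ▸ h0)
    obtain ⟨m, hm0, hm⟩ := exists_between (gaugePolynomial_pos hpos hx₀s)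
    set M := |Real.negMulLog x₀ - q.eval x₀| + 1
    have hM : 0 < M := by positivity
    refine ⟨M / m, by positivity, ?_⟩
    have h2 : ∀ᶠ x in 𝓝 x₀, |Real.negMulLog x - q.eval x| < M := by
      have hc : Continuous fun x : ℝ => |Real.negMulLog x - q.eval x| := by fun_prop
      exact (hc.tendsto x₀).eventually (gt_mem_nhds (lt_add_one _))
    have h3 : ∀ᶠ x in 𝓝 x₀, m < (gaugePolynomial s).eval x :=
      ((gaugePolynomial s).continuous.tendsto x₀).eventually (lt_mem_nhds hm)
    filter_upwards [h2.filter_mono nhdsWithin_le_nhds, h3.filter_mono nhdsWithin_le_nhds]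
      with x h2 h3
    calc _ ≤ M := h2.le
      _ = 0 + M / m * m := by field_simp; ring
      _ ≤ _ := by gcongr; positivity

theorem exists_negMulLog_approx {s : Finset ℝ} (h0 : 0 ∈ s) {q : ℝ[X]}
    (hq : ∀ c ∈ s, q.eval c = Real.negMulLog c)
    (hq' : ∀ c ∈ s, c ≠ 0 → (derivative q).eval c = -Real.log c - 1)
    {ε : ℝ} (hε : 0 < ε) (K : ℝ) :
    ∃ C : ℝ, 0 ≤ C ∧ ∀ x ∈ Set.Icc 0 K, |Real.negMulLog x - q.eval x| ≤
        ε * √((gaugePolynomial s).eval x) + C * (gaugePolynomial s).eval x := by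
  -- The compactness induction runs over arbitrary sets, not only subsets of the interval; enlarging
  -- `C` is harmless only where the gauge is nonnegative, so `0 ≤ x` is carried along.
  suffices h : ∃ C : ℝ, 0 ≤ C ∧ ∀ x ∈ Set.Icc 0 K, 0 ≤ x → |Real.negMulLog x - q.eval x| ≤
        ε * √((gaugePolynomial s).eval x) + C * (gaugePolynomial s).eval x by
    obtain ⟨C, hC, h⟩ := h
    exact ⟨C, hC, fun x hx => h x hx hx.1⟩
  refine isCompact_Icc.induction_on (p := fun t => ∃ C : ℝ, 0 ≤ C ∧ ∀ x ∈ t, 0 ≤ x →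
    |Real.negMulLog x - q.eval x| ≤
        ε * √((gaugePolynomial s).eval x) + C * (gaugePolynomial s).eval x)
    ⟨0, le_rfl, by simp⟩ ?_ ?_ ?_
  · rintro t u htu ⟨C, hC, h⟩
    exact ⟨C, hC, fun x hx => h x (htu hx)⟩
  · rintro t u ⟨C, hC, h⟩ ⟨D, hD, h'⟩
    refine ⟨max C D, le_max_of_le_left hC, fun x hx hx0 => ?_⟩
    have hr := gaugePolynomial_nonneg s hx0
    rcases hx with hx | hx
    · exact (h x hx hx0).trans (by gcongr; exact le_max_left _ _)
    · exact (h' x hx hx0).trans (by gcongr; exact le_max_right _ _)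
  · intro x hx
    obtain ⟨C, hC, h⟩ := exists_negMulLog_approx_local h0 hq hq' hε hx.1
    have h' : {y | |Real.negMulLog y - q.eval y| ≤ ε * √((gaugePolynomial s).eval y) +
        C * (gaugePolynomial s).eval y} ∈ 𝓝[Set.Icc 0 K] x :=
      nhdsWithin_mono x Set.Icc_subset_Ici_self h
    exact ⟨_, h', C, hC, fun y hy _ => hy⟩

/-! ### Derivatives of trace functions -/

section TraceFunctions

open scoped Matrix.Norms.Operator ComplexOrder

variable {n : Type*} [Fintype n] [DecidableEq n]

theorem trace_pow_eq_sum_eigenvalues {M : Matrix n n ℂ} (hM : M.IsHermitian) (k : ℕ) :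
    (M ^ k).trace = ∑ i, ((hM.eigenvalues i ^ k : ℝ) : ℂ) := by
  conv_lhs => rw [hM.spectral_theorem, ← map_pow, Matrix.diagonal_pow,
    Unitary.conjStarAlgAut_apply, Matrix.trace_mul_cycle, Unitary.coe_star_mul_self, one_mul,
    Matrix.trace_diagonal]
  simp

theorem re_trace_aeval {M : Matrix n n ℂ} (hM : M.IsHermitian) (p : ℝ[X]) :
    (aeval M p).trace.re = ∑ i, p.eval (hM.eigenvalues i) := by
  rw [aeval_eq_sum_range, Matrix.trace_sum, Complex.re_sum]
  simp only [eval_eq_sum_range, Matrix.trace_smul, trace_pow_eq_sum_eigenvalues hM,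
    Complex.real_smul, Complex.re_ofReal_mul, Complex.re_sum, Complex.ofReal_re]
  rw [Finset.sum_comm]
  simp only [Finset.mul_sum]

/-- The real part of the trace, as a real-linear functional. -/
def reTrace (n : Type*) [Fintype n] [DecidableEq n] : Matrix n n ℂ →L[ℝ] ℝ :=
  LinearMap.toContinuousLinearMap (Complex.reLm ∘ₗ Matrix.traceLinearMap n ℝ ℂ)

theorem reTrace_apply (M : Matrix n n ℂ) : reTrace n M = M.trace.re := rfl

/-- The matrix and its derivative need not commute, but cyclicity of the trace makes all summands of
the product rule equal. -/
theorem hasDerivAt_reTrace_pow {ρ : ℝ → Matrix n n ℂ} {ρ' : Matrix n n ℂ} {t : ℝ}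
    (h : HasDerivAt ρ ρ' t) (k : ℕ) :
    HasDerivAt (fun t => reTrace n (ρ t ^ k)) (k * reTrace n (ρ t ^ (k - 1) * ρ')) t := by
  have key := (reTrace n).hasFDerivAt.comp_hasDerivAt t (h.fun_pow' k)
  suffices hs : reTrace n (∑ i ∈ Finset.range k, ρ t ^ (k.pred - i) * ρ' * ρ t ^ i) =
      k * reTrace n (ρ t ^ (k - 1) * ρ') from hs ▸ key
  rw [map_sum, Finset.sum_congr rfl (g := fun _ => reTrace n (ρ t ^ (k - 1) * ρ'))]
  · simp
  · intro i hi
    have hi : i < k := Finset.mem_range.1 hi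
    rw [reTrace_apply, reTrace_apply, Matrix.trace_mul_comm, ← mul_assoc, ← pow_add]
    congr 4
    simp only [Nat.pred_eq_sub_one]; omega

theorem hasDerivAt_re_trace_aeval {ρ : ℝ → Matrix n n ℂ} {ρ' : Matrix n n ℂ} {t : ℝ}
    (h : HasDerivAt ρ ρ' t) (p : ℝ[X]) :
    HasDerivAt (fun t => (aeval (ρ t) p).trace.re)
      (aeval (ρ t) (derivative p) * ρ').trace.re t := by
  simp only [← reTrace_apply]
  induction p using Polynomial.induction_on' with
  | add p q hp hq =>
    simp only [map_add, add_mul]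
    exact hp.add hq
  | monomial k a =>
    simp only [aeval_monomial, derivative_monomial, ← Algebra.smul_def, map_smul, smul_mul_assoc,
      smul_eq_mul]
    rw [mul_assoc]
    exact (hasDerivAt_reTrace_pow h k).const_mul a

theorem contDiff_re_trace_aeval {ρ : ℝ → Matrix n n ℂ} {m : WithTop ℕ∞}
    (h : ContDiff ℝ m ρ) (p : ℝ[X]) : ContDiff ℝ m (fun t => (aeval (ρ t) p).trace.re) := by
  simp only [← reTrace_apply]
  refine (reTrace n).contDiff.comp ?_
  simp only [aeval_eq_sum_range]
  exact ContDiff.sum fun i _ => (h.pow i).const_smul _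

/-- The point `0` is a minimum, so the first-order Taylor term vanishes. -/
theorem exists_le_mul_sq_of_contDiff {h : ℝ → ℝ} (hC : ContDiff ℝ 2 h) (h0 : h 0 = 0)
    (hnn : ∀ t, 0 ≤ h t) : ∃ C : ℝ, 0 ≤ C ∧ ∀ᶠ t in 𝓝 0, h t ≤ C * t ^ 2 := by
  have hd : deriv h 0 = 0 := by
    refine IsLocalMin.deriv_eq_zero (Eventually.of_forall fun t => ?_)
    rw [h0]; exact hnn t
  have := taylor_isLittleO_univ (x₀ := 0) (n := 2) hC
  set D := iteratedDerivWithin 2 h Set.univ 0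
  have h1 : ∀ t, taylorWithinEval h 2 Set.univ 0 t = D / 2 * t ^ 2 := by
    intro t
    rw [taylorWithinEval_succ, taylorWithinEval_succ, taylor_within_zero_eval]
    simp only [h0, D, iteratedDerivWithin_univ, zero_add, iteratedDeriv_one, hd]
    simp
    ring
  refine ⟨|D| / 2 + 1, by positivity, ?_⟩
  filter_upwards [this.def one_pos] with t ht
  rw [h1, sub_zero, one_mul, Real.norm_eq_abs, norm_pow, Real.norm_eq_abs, sq_abs] at ht
  have h2 := (abs_le.1 ht).2
  have h3 := mul_le_mul_of_nonneg_right (le_abs_self D) (sq_nonneg t)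
  linarith

theorem hasDerivAt_sum_negMulLog_eigenvalues {ρ : ℝ → Matrix n n ℂ} {ρ' : Matrix n n ℂ}
    (hρ : ∀ t, (ρ t).PosSemidef) (hC : ContDiff ℝ 2 ρ) (hd : HasDerivAt ρ ρ' 0)
    {s : Finset ℝ} (h0 : 0 ∈ s) (hs : ∀ i, (hρ 0).1.eigenvalues i ∈ s) {q : ℝ[X]}
    (hq : ∀ c ∈ s, q.eval c = Real.negMulLog c)
    (hq' : ∀ c ∈ s, c ≠ 0 → (derivative q).eval c = -Real.log c - 1) :
    HasDerivAt (fun t => ∑ i, Real.negMulLog ((hρ t).1.eigenvalues i))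
      (aeval (ρ 0) (derivative q) * ρ').trace.re 0 := by
  have hnn : ∀ t i, 0 ≤ (hρ t).1.eigenvalues i := fun t i => (hρ t).eigenvalues_nonneg i
  set h : ℝ → ℝ := fun t => (aeval (ρ t) (gaugePolynomial s)).trace.re with hh
  have hsum : ∀ t, h t = ∑ i, (gaugePolynomial s).eval ((hρ t).1.eigenvalues i) :=
    fun t => re_trace_aeval (hρ t).1 _
  have hge : ∀ t i, (gaugePolynomial s).eval ((hρ t).1.eigenvalues i) ≤ h t := fun t i => by
    rw [hsum]
    exact Finset.single_le_sum (f := fun i => (gaugePolynomial s).eval ((hρ t).1.eigenvalues i))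
      (fun j _ => gaugePolynomial_nonneg s (hnn t j)) (Finset.mem_univ i)
  have hhnn : ∀ t, 0 ≤ h t := fun t => by
    rw [hsum]; exact Finset.sum_nonneg fun j _ => gaugePolynomial_nonneg s (hnn t j)
  have hh0 : h 0 = 0 := by
    rw [hsum]; exact Finset.sum_eq_zero fun i _ => gaugePolynomial_eq_zero (hs i)
  obtain ⟨D, hD, hDt⟩ :=
    exists_le_mul_sq_of_contDiff (contDiff_re_trace_aeval hC (gaugePolynomial s)) hh0 hhnn
  have hqd := hasDerivAt_re_trace_aeval hd q
  -- Nonnegative eigenvalues are bounded by the trace, which is continuous in `t`.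
  obtain ⟨K, hK⟩ : ∃ K : ℝ, ∀ᶠ t in 𝓝 0, ∀ i, (hρ t).1.eigenvalues i ≤ K := by
    have hc : Continuous fun t => reTrace n (ρ t) := (reTrace n).continuous.comp hC.continuous
    refine ⟨reTrace n (ρ 0) + 1, ?_⟩
    filter_upwards [(hc.tendsto 0).eventually (gt_mem_nhds (lt_add_one _))] with t ht i
    refine le_trans ?_ ht.le
    have := re_trace_aeval (hρ t).1 X
    simp only [aeval_X, eval_X] at this
    rw [reTrace_apply, this]
    exact Finset.single_le_sum (f := fun i => (hρ t).1.eigenvalues i)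
      (fun j _ => hnn t j) (Finset.mem_univ i)
  have herr : HasDerivAt (fun t => ∑ i, Real.negMulLog ((hρ t).1.eigenvalues i) -
      (aeval (ρ t) q).trace.re) 0 0 := by
    have he0 : ∑ i, Real.negMulLog ((hρ 0).1.eigenvalues i) - (aeval (ρ 0) q).trace.re = 0 := by
      rw [re_trace_aeval (hρ 0).1, sub_eq_zero]
      exact Finset.sum_congr rfl fun i _ => (hq _ (hs i)).symm
    rw [hasDerivAt_iff_isLittleO, he0]
    simp only [sub_zero, smul_zero]
    refine Asymptotics.IsLittleO.of_bound fun ε hε => ?_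
    set N : ℝ := (Fintype.card n : ℝ) with hN
    -- Chosen so that the `√g` terms of all eigenvalues contribute at most `ε / 2 * |t|`; the `+ 1`s
    -- keep the denominator positive.
    set ε' := ε / (2 * (N + 1) * (√D + 1)) with hε'
    have hε'0 : 0 < ε' := by positivity
    obtain ⟨C, hC0, hCx⟩ := exists_negMulLog_approx h0 hq hq' hε'0 K
    have hsmall : ∀ᶠ t in 𝓝 (0 : ℝ), N * (C * D) * |t| < ε / 2 := by
      have hc : Continuous fun t : ℝ => N * (C * D) * |t| := by fun_prop
      have := hc.tendsto 0
      simp only [abs_zero, mul_zero] at this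
      exact this.eventually (gt_mem_nhds (by positivity))
    filter_upwards [hDt, hK, hsmall] with t h1 h2 h3
    rw [re_trace_aeval (hρ t).1, ← Finset.sum_sub_distrib]
    have h4 : √(h t) ≤ √D * |t| := by
      rw [← Real.sqrt_sq_eq_abs, ← Real.sqrt_mul hD]
      exact Real.sqrt_le_sqrt h1
    have hbound : ∀ i, |Real.negMulLog ((hρ t).1.eigenvalues i) -
        q.eval ((hρ t).1.eigenvalues i)| ≤ ε' * (√D * |t|) + C * (D * t ^ 2) := fun i => by
      refine (hCx _ ⟨hnn t i, h2 i⟩).trans ?_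
      have := (hge t i).trans h1
      gcongr
      exact (Real.sqrt_le_sqrt (hge t i)).trans h4
    refine (Finset.abs_sum_le_sum_abs _ _).trans ((Finset.sum_le_sum fun i _ => hbound i).trans ?_)
    rw [Finset.sum_const, Finset.card_univ, nsmul_eq_mul, Real.norm_eq_abs]
    have hfirst : N * (ε' * (√D * |t|)) ≤ ε / 2 * |t| := by
      have : N * (ε' * √D) ≤ ε / 2 := by
        have hs : 0 ≤ √D := Real.sqrt_nonneg D
        have hN : 0 ≤ N := Nat.cast_nonneg _
        calc N * (ε' * √D) ≤ (N + 1) * (ε' * (√D + 1)) := by gcongr <;> linarith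
          _ = ε / 2 := by rw [hε']; field_simp
      calc _ = N * (ε' * √D) * |t| := by ring
        _ ≤ _ := by gcongr
    have hsecond : N * (C * (D * t ^ 2)) ≤ ε / 2 * |t| := by
      calc _ = N * (C * D) * |t| * |t| := by rw [← sq_abs]; ring
        _ ≤ _ := by gcongr
    calc _ = N * (ε' * (√D * |t|)) + N * (C * (D * t ^ 2)) := by ring
      _ ≤ _ := by linarith
  have hadd := herr.add hqd
  rw [zero_add] at hadd
  exact hadd.congr_of_eventuallyEq (Eventually.of_forall fun t => by simp)

end TraceFunctions

/-! ### The rate in terms of a Schmidt decomposition -/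

/-- An orthonormal family of vectors. -/
def IsOrthonormalFamily {ι A : Type*} [DecidableEq ι] [Fintype A] (u : ι → A → ℂ) : Prop :=
  ∀ i j, star (u i) ⬝ᵥ u j = if i = j then 1 else 0

/-- `ψ = ∑ i, √(l i) u i ⊗ v i` with orthonormal families `u`, `v`. -/
structure IsSchmidt {ι A B : Type*} [Fintype ι] [DecidableEq ι] [Fintype A] [Fintype B]
    (ψ : A × B → ℂ) (l : ι → ℝ) (u : ι → A → ℂ) (v : ι → B → ℂ) : Prop where
  nonneg : ∀ i, 0 ≤ l i
  left : IsOrthonormalFamily u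
  right : IsOrthonormalFamily v
  eq_sum : ψ = ∑ i, ((√(l i) : ℝ) : ℂ) • tensorVec (u i) (v i)

/-- The matrix element of `H` between `u i ⊗ v i` and `u j ⊗ v j`. -/
def matrixElement {ι A B : Type*} [Fintype A] [Fintype B] (H : Matrix (A × B) (A × B) ℂ)
    (u : ι → A → ℂ) (v : ι → B → ℂ) (i j : ι) : ℂ :=
  star (tensorVec (u i) (v i)) ⬝ᵥ (H *ᵥ tensorVec (u j) (v j))

/-- The entanglement rate of `H` at `∑ i, √(l i) u i ⊗ v i`. -/
def schmidtRate {ι A B : Type*} [Fintype ι] [Fintype A] [Fintype B]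
    (H : Matrix (A × B) (A × B) ℂ) (l : ι → ℝ) (u : ι → A → ℂ) (v : ι → B → ℂ) : ℝ :=
  -(2 * ∑ i, ∑ j, √(l i) * √(l j) * Real.logb 2 (l i) * (matrixElement H u v i j).im)

section Rate

variable {ι A B : Type*} [Fintype A] [Fintype B]

theorem matrixElement_swap {H : Matrix (A × B) (A × B) ℂ} (hH : H.IsHermitian)
    (u : ι → A → ℂ) (v : ι → B → ℂ) (i j : ι) :
    matrixElement H u v j i = star (matrixElement H u v i j) := by
  rw [matrixElement, matrixElement, Matrix.star_dotProduct, Matrix.star_mulVec, hH.eq,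
    Matrix.dotProduct_mulVec]

variable [Fintype ι]

/-- The double sum is the imaginary part of the expectation of `H`, zero because `Im (h i j)` is
antisymmetric. It removes the contribution of the `-1` in the derivative of `-x log x`. -/
theorem sum_sqrt_mul_im_matrixElement {H : Matrix (A × B) (A × B) ℂ} (hH : H.IsHermitian)
    (l : ι → ℝ) (u : ι → A → ℂ) (v : ι → B → ℂ) :
    ∑ i, ∑ j, √(l i) * √(l j) * (matrixElement H u v i j).im = 0 := by
  have h : ∑ i, ∑ j, √(l i) * √(l j) * (matrixElement H u v i j).im =
      -∑ i, ∑ j, √(l i) * √(l j) * (matrixElement H u v i j).im := by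
    conv_lhs => rw [Finset.sum_comm]
    simp only [← Finset.sum_neg_distrib]
    refine Finset.sum_congr rfl fun i _ => Finset.sum_congr rfl fun j _ => ?_
    rw [matrixElement_swap hH u v i j]
    rw [Complex.star_def, Complex.conj_im]
    ring
  linarith

variable [DecidableEq ι] {ψ : A × B → ℂ} {l : ι → ℝ} {u : ι → A → ℂ} {v : ι → B → ℂ}

theorem IsSchmidt.apply (h : IsSchmidt ψ l u v) (a : A) (b : B) :
    ψ (a, b) = ∑ i, (√(l i) : ℂ) * (u i a * v i b) := by
  rw [h.eq_sum]; simp [tensorVec]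

theorem IsSchmidt.reducedDensity_mulVec (h : IsSchmidt ψ l u v) (i : ι) :
    reducedDensity ψ *ᵥ u i = (l i : ℂ) • u i := by
  have hr : reducedDensity ψ = ∑ j, (l j : ℂ) • Matrix.vecMulVec (u j) (star (u j)) := by
    ext a a'
    simp only [reducedDensity, Matrix.of_apply, Matrix.sum_apply, Matrix.smul_apply,
      Matrix.vecMulVec_apply, h.apply, star_sum, star_mul', Finset.sum_mul_sum, Pi.star_apply,
      smul_eq_mul]
    rw [Finset.sum_comm]
    refine Finset.sum_congr rfl fun j _ => ?_
    rw [Finset.sum_comm, Finset.sum_eq_single j]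
    · have hv := h.right j j
      simp only [if_true, dotProduct, Pi.star_apply] at hv
      have hl : (l j : ℂ) = (√(l j) : ℂ) * √(l j) := by
        rw [← Complex.ofReal_mul, Real.mul_self_sqrt (h.nonneg j)]
      rw [hl]
      calc _ = (√(l j) : ℂ) * √(l j) * (u j a * star (u j a')) * ∑ b, star (v j b) * v j b := by
            rw [Finset.mul_sum]
            refine Finset.sum_congr rfl fun b _ => ?_
            simp
            ring
        _ = _ := by rw [hv, mul_one]
    · intro k _ hk
      have hv := h.right k j
      simp only [if_neg hk, dotProduct, Pi.star_apply] at hv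
      calc _ = (√(l j) : ℂ) * star (√(l k) : ℂ) * (u j a * star (u k a')) *
              ∑ b, star (v k b) * v j b := by
            rw [Finset.mul_sum]
            refine Finset.sum_congr rfl fun b _ => ?_
            ring
        _ = _ := by rw [hv, mul_zero]
    · simp
  rw [hr, Matrix.sum_mulVec, Finset.sum_eq_single i]
  · rw [Matrix.smul_mulVec, Matrix.vecMulVec_mulVec, h.left]
    simp
  · intro j _ hj
    rw [Matrix.smul_mulVec, Matrix.vecMulVec_mulVec, h.left, if_neg hj]
    simp
  · simp

open scoped ComplexOrder in
theorem posSemidef_reducedDensity (ψ : A × B → ℂ) : (reducedDensity ψ).PosSemidef := by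
  have : reducedDensity ψ = (Matrix.of fun a b => ψ (a, b)) * (Matrix.of fun a b => ψ (a, b))ᴴ := by
    ext a a'; simp [reducedDensity, Matrix.mul_apply]
  rw [this]
  exact Matrix.posSemidef_self_mul_conjTranspose _

variable [DecidableEq A]

theorem aeval_mulVec_of_eigenvector {M : Matrix A A ℂ} {w : A → ℂ} {c : ℝ}
    (h : M *ᵥ w = (c : ℂ) • w) (p : ℝ[X]) : aeval M p *ᵥ w = ((p.eval c : ℝ) : ℂ) • w := by
  have hpow : ∀ k : ℕ, M ^ k *ᵥ w = ((c ^ k : ℝ) : ℂ) • w := fun k => by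
    induction k with
    | zero => simp
    | succ k ih =>
      rw [pow_succ, ← Matrix.mulVec_mulVec, h, Matrix.mulVec_smul, ih, smul_smul]
      push_cast; ring_nf
  rw [aeval_eq_sum_range, Matrix.sum_mulVec, eval_eq_sum_range, Complex.ofReal_sum,
    Finset.sum_smul]
  refine Finset.sum_congr rfl fun k _ => ?_
  rw [Matrix.smul_mulVec, hpow, Complex.ofReal_mul, mul_smul]
  rfl

/-! ### Differentiating the evolution, the reduced state and the entropy -/

section Calculus

open scoped Matrix.Norms.Operator ComplexOrder

/-- Matrices as functions of two indices, as a continuous linear equivalence. -/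
def matrixEquiv (A B : Type*) [Fintype A] [Fintype B] :
    (A → B → ℂ) ≃L[ℝ] Matrix A B ℂ :=
  (Matrix.ofLinearEquiv ℝ).toContinuousLinearEquiv

/-- Application of a matrix to a fixed vector, as a continuous linear map. -/
def mulVecCLM (ψ : A → ℂ) : Matrix A A ℂ →L[ℝ] (A → ℂ) :=
  LinearMap.toContinuousLinearMap
    { toFun := fun M => M *ᵥ ψ
      map_add' := fun M N => Matrix.add_mulVec M N ψ
      map_smul' := fun c M => Matrix.smul_mulVec c M ψ }

theorem evolve_eq (H : Matrix A A ℂ) (ψ : A → ℂ) :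
    (fun t : ℝ => evolve H t ψ) =
      fun t : ℝ => mulVecCLM ψ (NormedSpace.exp (t • (-Complex.I • H))) := by
  funext t
  have : (-Complex.I * (t : ℂ)) • H = t • (-Complex.I • H) := by
    ext i j; simp; ring
  rw [evolve, this]
  rfl

theorem evolve_zero (H : Matrix A A ℂ) (ψ : A → ℂ) : evolve H 0 ψ = ψ := by
  simp [evolve]

theorem contDiff_evolve (H : Matrix A A ℂ) (ψ : A → ℂ) {n : WithTop ℕ∞} :
    ContDiff ℝ n fun t : ℝ => evolve H t ψ := by
  rw [evolve_eq]
  refine (mulVecCLM ψ).contDiff.comp ?_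
  have h1 : ContDiff ℝ n (NormedSpace.exp : Matrix A A ℂ → Matrix A A ℂ) :=
    contDiff_iff_contDiffAt.2 fun x => (NormedSpace.exp_analytic (𝕂 := ℝ) x).contDiffAt
  exact h1.comp (contDiff_id.smul contDiff_const)

theorem hasDerivAt_evolve (H : Matrix A A ℂ) (ψ : A → ℂ) :
    HasDerivAt (fun t : ℝ => evolve H t ψ) (-Complex.I • (H *ᵥ ψ)) 0 := by
  rw [evolve_eq]
  have h1 := hasDerivAt_exp_smul_const (𝕂 := ℝ) (-Complex.I • H) (0 : ℝ)
  have h2 := (mulVecCLM ψ).hasFDerivAt.comp_hasDerivAt (0 : ℝ) h1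
  rw [zero_smul, NormedSpace.exp_zero, one_mul] at h2
  have h3 : mulVecCLM ψ (-Complex.I • H) = -Complex.I • (H *ᵥ ψ) := Matrix.smul_mulVec _ _ _
  rw [← h3]
  exact h2

theorem contDiff_reducedDensity {A B : Type*} [Fintype A] [Fintype B]
    {ψ : ℝ → A × B → ℂ} {n : WithTop ℕ∞} (h : ContDiff ℝ n ψ) :
    ContDiff ℝ n fun t => reducedDensity (ψ t) := by
  refine (matrixEquiv A A).contDiff.comp (f := fun t a a' => ∑ b, ψ t (a, b) * star (ψ t (a', b))) ?_
  refine contDiff_pi.2 fun a => contDiff_pi.2 fun a' => ContDiff.sum fun b _ => ?_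
  have h1 := contDiff_pi.1 h
  exact (h1 _).mul ((starL' ℝ : ℂ ≃L[ℝ] ℂ).contDiff.comp (h1 _))

/-- The derivative of the reduced density matrix in the direction `φ`. -/
def reducedVariation (ψ φ : A × B → ℂ) : Matrix A A ℂ :=
  Matrix.of fun a a' => ∑ b, (φ (a, b) * star (ψ (a', b)) + ψ (a, b) * star (φ (a', b)))

theorem hasDerivAt_reducedDensity {A B : Type*} [Fintype A] [Fintype B]
    {ψ : ℝ → A × B → ℂ} {φ : A × B → ℂ} {t : ℝ}
    (h : HasDerivAt ψ φ t) :
    HasDerivAt (fun t => reducedDensity (ψ t)) (reducedVariation (ψ t) φ) t := by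
  refine (matrixEquiv A A).hasFDerivAt.comp_hasDerivAt t
    (f := fun t a a' => ∑ b, ψ t (a, b) * star (ψ t (a', b)))
    (f' := fun a a' => ∑ b, (φ (a, b) * star (ψ t (a', b)) + ψ t (a, b) * star (φ (a', b)))) ?_
  refine hasDerivAt_pi.2 fun a => hasDerivAt_pi.2 fun a' => HasDerivAt.fun_sum fun b _ => ?_
  have h1 := hasDerivAt_pi.1 h
  exact (h1 _).mul (h1 _).star

/-- The variation is a matrix plus its adjoint, so against a Hermitian `L` the two traces are
conjugate. -/
theorem re_trace_mul_reducedVariation {L : Matrix A A ℂ} (hL : L.IsHermitian)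
    (ψ φ : A × B → ℂ) :
    (L * reducedVariation ψ φ).trace.re =
      2 * (∑ b, star (fun a => φ (a, b)) ⬝ᵥ (L *ᵥ fun a => ψ (a, b))).re := by
  set P : Matrix A B ℂ := Matrix.of fun a b => ψ (a, b)
  set F : Matrix A B ℂ := Matrix.of fun a b => φ (a, b)
  have h1 : reducedVariation ψ φ = F * Pᴴ + P * Fᴴ := by
    ext a a'
    simp [reducedVariation, Matrix.mul_apply, Finset.sum_add_distrib, P, F]
  have h2 : (L * (F * Pᴴ)).trace = star (L * (P * Fᴴ)).trace := by
    rw [← Matrix.trace_conjTranspose, Matrix.conjTranspose_mul, Matrix.conjTranspose_mul,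
      Matrix.conjTranspose_conjTranspose, hL.eq, Matrix.trace_mul_comm]
  have h3 : (L * (P * Fᴴ)).trace =
      ∑ b, star (fun a => φ (a, b)) ⬝ᵥ (L *ᵥ fun a => ψ (a, b)) := by
    rw [← Matrix.mul_assoc, Matrix.trace_mul_comm]
    rfl
  rw [h1, mul_add, Matrix.trace_add, h2, h3, Complex.add_re, Complex.star_def, Complex.conj_re]
  ring

theorem hasDerivAt_entanglement [DecidableEq B]
    {H : Matrix (A × B) (A × B) ℂ} (hH : H.IsHermitian)
    (h : IsSchmidt ψ l u v) :
    HasDerivAt (fun t : ℝ => entanglement (evolve H t ψ)) (schmidtRate H l u v) 0 := by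
  classical
  set ρ : ℝ → Matrix A A ℂ := fun t => reducedDensity (evolve H t ψ) with hρdef
  have hρ : ∀ t, (ρ t).PosSemidef := fun t => posSemidef_reducedDensity _
  have hρ0 : ρ 0 = reducedDensity ψ := by rw [hρdef]; simp only [evolve_zero]
  have hC : ContDiff ℝ 2 ρ := contDiff_reducedDensity (contDiff_evolve H ψ)
  have hd : HasDerivAt ρ (reducedVariation ψ (-Complex.I • (H *ᵥ ψ))) 0 := by
    have := hasDerivAt_reducedDensity (hasDerivAt_evolve H ψ)
    rwa [evolve_zero] at this
  -- Including the weights `l i` among the nodes allows the interpolation conditions to be used at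
  -- them directly. If `l i = 0`, the derivative prescribed there is irrelevant: the term carries
  -- the factor `√(l i)`.
  set s : Finset ℝ := insert 0 (Finset.univ.image (hρ 0).1.eigenvalues ∪ Finset.univ.image l)
  have hev : ∀ i, (hρ 0).1.eigenvalues i ∈ s := fun i => by simp [s]
  have hl : ∀ i, l i ∈ s := fun i => by simp [s]
  obtain ⟨q, hq⟩ := exists_hermite_interpolation s Real.negMulLog fun x => -Real.log x - 1
  have key := (hasDerivAt_sum_negMulLog_eigenvalues hρ hC hd (Finset.mem_insert_self _ _) hev
    (fun c hc => (hq c hc).1) fun c hc _ => (hq c hc).2).div_const (Real.log 2)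
  have hE : (fun t : ℝ => entanglement (evolve H t ψ)) =
      fun t => (∑ i, Real.negMulLog ((hρ t).1.eigenvalues i)) / Real.log 2 := by
    funext t
    rw [entanglement, vonNeumannEntropy, Finset.sum_div, ← Finset.sum_neg_distrib]
    refine Finset.sum_congr rfl fun i _ => ?_
    rw [Real.negMulLog, Real.logb]
    ring
  rw [hE]
  set L := aeval (ρ 0) (derivative q) with hLdef
  have hL : L.IsHermitian := by
    rw [hLdef, Matrix.IsHermitian, aeval_eq_sum_range, Matrix.conjTranspose_sum]
    refine Finset.sum_congr rfl fun k _ => ?_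
    rw [Matrix.conjTranspose_smul, star_trivial, ((hρ 0).1.pow k).eq]
  suffices hval : schmidtRate H l u v =
      (L * reducedVariation ψ (-Complex.I • (H *ᵥ ψ))).trace.re / Real.log 2 from hval ▸ key
  rw [re_trace_mul_reducedVariation hL]
  have hLu : ∀ i, L *ᵥ u i = ((-Real.log (l i) - 1 : ℝ) : ℂ) • u i := fun i => by
    rw [hLdef, hρ0, aeval_mulVec_of_eigenvector (h.reducedDensity_mulVec i), (hq _ (hl i)).2]
  have hLψ : ∀ b, (L *ᵥ fun a => ψ (a, b)) =
      ∑ i, ((√(l i) * (-Real.log (l i) - 1) : ℝ) : ℂ) • v i b • u i := fun b => by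
    have : (fun a => ψ (a, b)) = ∑ i, (√(l i) : ℂ) • v i b • u i := by
      funext a
      rw [h.apply]
      simp [mul_comm]
    rw [this, Matrix.mulVec_sum]
    refine Finset.sum_congr rfl fun i _ => ?_
    rw [Matrix.mulVec_smul, Matrix.mulVec_smul, hLu, smul_comm (v i b), smul_smul,
      Complex.ofReal_mul]
  have hsum : ∑ b, star (fun a => (-Complex.I • (H *ᵥ ψ)) (a, b)) ⬝ᵥ (L *ᵥ fun a => ψ (a, b)) =
      Complex.I * ∑ i, ∑ j, ((√(l i) * √(l j) * (-Real.log (l i) - 1) : ℝ) : ℂ) *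
        star (matrixElement H u v i j) := by
    have hHψ : ∀ i, star (H *ᵥ ψ) ⬝ᵥ tensorVec (u i) (v i) =
        ∑ j, (√(l j) : ℂ) * star (matrixElement H u v i j) := fun i => by
      rw [← star_star (star (H *ᵥ ψ) ⬝ᵥ _), ← Matrix.star_dotProduct, h.eq_sum, Matrix.mulVec_sum,
        dotProduct_sum, star_sum]
      refine Finset.sum_congr rfl fun j _ => ?_
      rw [Matrix.mulVec_smul, dotProduct_smul, smul_eq_mul, star_mul', matrixElement]
      simp
    have hi : ∀ i, ∑ j, ((√(l i) * √(l j) * (-Real.log (l i) - 1) : ℝ) : ℂ) *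
        star (matrixElement H u v i j) = ((√(l i) * (-Real.log (l i) - 1) : ℝ) : ℂ) *
          (star (H *ᵥ ψ) ⬝ᵥ tensorVec (u i) (v i)) := fun i => by
      rw [hHψ, Finset.mul_sum]
      refine Finset.sum_congr rfl fun j _ => ?_
      push_cast; ring
    simp only [hi, hLψ, dotProduct_sum, dotProduct_smul, Finset.mul_sum]
    rw [Finset.sum_comm]
    refine Finset.sum_congr rfl fun i _ => ?_
    simp only [smul_eq_mul, dotProduct, Fintype.sum_prod_type_right, Finset.mul_sum]
    refine Finset.sum_congr rfl fun b _ => Finset.sum_congr rfl fun a _ => ?_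
    simp [tensorVec]
    ring
  have h0 := sum_sqrt_mul_im_matrixElement hH l u v
  have hlog : Real.log 2 ≠ 0 := (Real.log_pos one_lt_two).ne'
  have hdecomp : ∑ i, ∑ j, √(l i) * √(l j) * (-Real.log (l i) - 1) * (matrixElement H u v i j).im =
      -(Real.log 2 * ∑ i, ∑ j, √(l i) * √(l j) * Real.logb 2 (l i) * (matrixElement H u v i j).im) -
        ∑ i, ∑ j, √(l i) * √(l j) * (matrixElement H u v i j).im := by
    simp only [Finset.mul_sum, ← Finset.sum_neg_distrib, ← Finset.sum_sub_distrib]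
    refine Finset.sum_congr rfl fun i _ => Finset.sum_congr rfl fun j _ => ?_
    rw [Real.logb]
    field_simp
  rw [h0, sub_zero] at hdecomp
  rw [hsum, Complex.I_mul_re, Complex.im_sum]
  simp only [Complex.im_sum, Complex.im_ofReal_mul, Complex.star_def, Complex.conj_im, mul_neg,
    Finset.sum_neg_distrib, neg_neg]
  rw [hdecomp, schmidtRate]
  field_simp

end Calculus

end Rate

end

/-! ### The constant `alpha` -/

/-- This form is continuous on the closed interval, since `Real.negMulLog` is continuous at `0`;
existence of the maximum then follows by compactness. -/
theorem isingRate_eq (x : ℝ) (hx : x ∈ Set.Icc (0 : ℝ) 1) :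
    isingRate x = 4 * (√x * Real.negMulLog √(1 - x) - √(1 - x) * Real.negMulLog √x) /
      Real.log 2 := by
  obtain ⟨h0, h1⟩ := hx
  rcases h0.eq_or_lt with rfl | h0
  · simp [isingRate]
  rcases h1.eq_or_lt with rfl | h1
  · simp [isingRate]
  have h2 : 0 < 1 - x := sub_pos.2 h1
  rw [isingRate, Real.sqrt_mul h0.le, Real.logb, Real.log_div h0.ne' h2.ne', Real.negMulLog,
    Real.negMulLog, Real.log_sqrt h0.le, Real.log_sqrt h2.le]
  ring

theorem exists_isMaxOn_isingRate :
    ∃ x₀ ∈ Set.Icc (0 : ℝ) 1, IsMaxOn isingRate (Set.Icc 0 1) x₀ := by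
  refine isCompact_Icc.exists_isMaxOn ⟨0, by simp⟩ (ContinuousOn.congr ?_ isingRate_eq)
  have : Continuous fun x : ℝ => 4 * (√x * Real.negMulLog √(1 - x) - √(1 - x) * Real.negMulLog √x) /
      Real.log 2 := by fun_prop
  exact this.continuousOn

theorem alpha_eq_of_isMaxOn {x₀ : ℝ} (hx₀ : x₀ ∈ Set.Icc (0 : ℝ) 1)
    (h : IsMaxOn isingRate (Set.Icc 0 1) x₀) : alpha = isingRate x₀ :=
  IsGreatest.csSup_eq ⟨Set.mem_image_of_mem _ hx₀, by
    rintro _ ⟨x, hx, rfl⟩; exact isMaxOn_iff.1 h x hx⟩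

theorem isingRate_le_alpha {x : ℝ} (hx : x ∈ Set.Icc (0 : ℝ) 1) : isingRate x ≤ alpha := by
  obtain ⟨x₀, hx₀, h⟩ := exists_isMaxOn_isingRate
  rw [alpha_eq_of_isMaxOn hx₀ h]
  exact isMaxOn_iff.1 h x hx

theorem alpha_nonneg : 0 ≤ alpha := by
  have h := isingRate_le_alpha (x := 0) (by simp)
  rwa [show isingRate 0 = 0 by simp [isingRate]] at h

/-- Homogeneity: two weights are normalized to the probabilities `x / (x + y)` and `y / (x + y)`,
which turns the one-variable maximum into a bound for each pair of Schmidt weights. -/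
theorem isingRate_div_add {x y : ℝ} (hx : 0 < x) (hy : 0 < y) :
    (x + y) * isingRate (x / (x + y)) = 2 * (√x * √y * (Real.logb 2 x - Real.logb 2 y)) := by
  have hxy : 0 < x + y := add_pos hx hy
  have h1 : 1 - x / (x + y) = y / (x + y) := by field_simp; ring
  have h2 : √(x / (x + y) * (y / (x + y))) = √x * √y / (x + y) := by
    rw [div_mul_div_comm, Real.sqrt_div' _ (by positivity), Real.sqrt_mul_self hxy.le,
      Real.sqrt_mul hx.le]
  rw [isingRate, h1, h2, div_div_div_cancel_right₀ hxy.ne',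
    Real.logb_div hx.ne' hy.ne']
  field_simp

theorem sqrt_mul_logb_sub_le {x y : ℝ} (hx : 0 ≤ x) (hy : 0 ≤ y) :
    √x * √y * (Real.logb 2 x - Real.logb 2 y) ≤ (x + y) * (alpha / 2) := by
  have := alpha_nonneg
  rcases hx.eq_or_lt with rfl | hx
  · simp only [Real.sqrt_zero, zero_mul]; positivity
  rcases hy.eq_or_lt with rfl | hy
  · simp only [Real.sqrt_zero, zero_mul, mul_zero]; positivity
  have hxy : 0 < x + y := add_pos hx hy
  have h1 := isingRate_div_add hx hy
  have h2 : isingRate (x / (x + y)) ≤ alpha :=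
    isingRate_le_alpha ⟨by positivity, (div_le_one hxy).2 (by linarith)⟩
  have := mul_le_mul_of_nonneg_left h2 hxy.le
  linarith

theorem abs_sqrt_mul_logb_sub_le {x y : ℝ} (hx : 0 ≤ x) (hy : 0 ≤ y) :
    |√x * √y * (Real.logb 2 x - Real.logb 2 y)| ≤ (x + y) * (alpha / 2) := by
  refine abs_le.2 ⟨?_, sqrt_mul_logb_sub_le hx hy⟩
  have := sqrt_mul_logb_sub_le hy hx
  linarith

/-! ### Existence of Schmidt decompositions -/

theorem sum_norm_sq_eq {A : Type*} [Fintype A] (w : A → ℂ) :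
    ((∑ i, ‖w i‖ ^ 2 : ℝ) : ℂ) = star w ⬝ᵥ w := by
  rw [Complex.ofReal_sum, dotProduct]
  refine Finset.sum_congr rfl fun b _ => ?_
  rw [Pi.star_apply, Complex.star_def, Complex.conj_mul']; simp

/-- In an eigenbasis of the reduced density matrix, the rows of the coefficient matrix are
orthogonal with squared norms the eigenvalues. Zero rows are dropped and the others normalized.
Strict positivity of the weights is needed later to split the logarithm of a product. -/
theorem exists_isSchmidt {A B : Type*} [Fintype A] [DecidableEq A] [Fintype B]
    (ψ : A × B → ℂ) :
    ∃ (s : Finset A) (l : s → ℝ) (u : s → A → ℂ) (v : s → B → ℂ),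
      IsSchmidt ψ l u v ∧ ∀ i, 0 < l i := by
  set hρ := reducedDensity_isHermitian ψ
  set U : Matrix A A ℂ := (hρ.eigenvectorUnitary : Matrix A A ℂ) with hU
  have hUU : star U * U = 1 := Unitary.coe_star_mul_self hρ.eigenvectorUnitary
  have hUU' : U * star U = 1 := Unitary.coe_mul_star_self hρ.eigenvectorUnitary
  set P : Matrix A B ℂ := Matrix.of fun a b => ψ (a, b) with hP
  set W : Matrix A B ℂ := star U * P with hW
  have hPW : P = U * W := by rw [hW, ← Matrix.mul_assoc, hUU', Matrix.one_mul]
  have hWW : W * Wᴴ = Matrix.diagonal fun i => (hρ.eigenvalues i : ℂ) := by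
    have h1 : P * Pᴴ = reducedDensity ψ := by
      ext a a'; simp [reducedDensity, Matrix.mul_apply, hP]
    have h2 := hρ.conjStarAlgAut_star_eigenvectorUnitary
    rw [Unitary.conjStarAlgAut_star_apply] at h2
    rw [hW, Matrix.conjTranspose_mul, Matrix.star_eq_conjTranspose,
      Matrix.conjTranspose_conjTranspose, Matrix.mul_assoc, ← Matrix.mul_assoc P, h1,
      ← Matrix.mul_assoc]
    exact h2
  have hWW' : ∀ i j, ∑ b, star (W i b) * W j b = if i = j then (hρ.eigenvalues i : ℂ) else 0 := by
    intro i j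
    have := congrFun (congrFun hWW j) i
    rw [Matrix.mul_apply, Matrix.diagonal_apply] at this
    simp only [Matrix.conjTranspose_apply] at this
    rw [Finset.sum_congr rfl fun b _ => mul_comm _ _, this]
    by_cases h : i = j
    · simp [h]
    · simp [h, Ne.symm h]
  have hnn : ∀ i, 0 ≤ hρ.eigenvalues i := fun i => (posSemidef_reducedDensity ψ).eigenvalues_nonneg i
  have hzero : ∀ i, hρ.eigenvalues i = 0 → ∀ b, W i b = 0 := by
    intro i hi b
    have h1 := hWW' i i
    rw [if_pos rfl, hi] at h1
    have h2 : ∑ b, ‖W i b‖ ^ 2 = 0 := by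
      have : ((∑ b, ‖W i b‖ ^ 2 : ℝ) : ℂ) = 0 := (sum_norm_sq_eq (W i)).trans h1
      exact_mod_cast this
    have h3 := (Finset.sum_eq_zero_iff_of_nonneg fun b _ => sq_nonneg ‖W i b‖).1 h2 b
      (Finset.mem_univ b)
    simpa using h3
  refine ⟨Finset.univ.filter fun i => hρ.eigenvalues i ≠ 0, fun i => hρ.eigenvalues i,
    fun i a => U a i, fun i b => (√(hρ.eigenvalues i) : ℂ)⁻¹ * W i b, ⟨fun i => hnn i, ?_, ?_, ?_⟩,
    fun i => lt_of_le_of_ne (hnn i) (Finset.mem_filter.1 i.2).2.symm⟩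
  · intro i j
    have := congrFun (congrFun hUU i) j
    rw [Matrix.mul_apply, Matrix.one_apply] at this
    simp only [dotProduct, Subtype.ext_iff]
    exact this
  · intro i j
    have hi : (√(hρ.eigenvalues i) : ℂ) ≠ 0 := by
      have := lt_of_le_of_ne (hnn i) (Finset.mem_filter.1 i.2).2.symm
      exact Complex.ofReal_ne_zero.2 (Real.sqrt_pos.2 this).ne'
    have h1 : star (fun b => (√(hρ.eigenvalues i) : ℂ)⁻¹ * W i b) ⬝ᵥ
        (fun b => (√(hρ.eigenvalues j) : ℂ)⁻¹ * W j b) =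
        (√(hρ.eigenvalues i) : ℂ)⁻¹ * (√(hρ.eigenvalues j) : ℂ)⁻¹ *
          ∑ b, star (W i b) * W j b := by
      simp only [dotProduct, Finset.mul_sum]
      refine Finset.sum_congr rfl fun b _ => ?_
      simp; ring
    rw [h1, hWW']
    by_cases h : i = j
    · subst h
      have hl : (hρ.eigenvalues i : ℂ) = (√(hρ.eigenvalues i) : ℂ) * √(hρ.eigenvalues i) := by
        rw [← Complex.ofReal_mul, Real.mul_self_sqrt (hnn i)]
      rw [if_pos rfl, if_pos rfl, hl]
      field_simp
    · rw [if_neg h, if_neg fun h' => h (Subtype.ext h'), mul_zero]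
  · funext ⟨a, b⟩
    have h1 : ψ (a, b) = ∑ i, U a i * W i b := by
      have := congrFun (congrFun hPW a) b
      rwa [Matrix.mul_apply] at this
    rw [h1, Finset.sum_apply, ← Finset.sum_filter_of_ne
      (p := fun i => hρ.eigenvalues i ≠ 0) fun i _ hi h => hi (by rw [hzero i h, mul_zero]),
      ← Finset.sum_coe_sort]
    refine Finset.sum_congr rfl fun i _ => ?_
    have hi : (√(hρ.eigenvalues i) : ℂ) ≠ 0 := by
      have := lt_of_le_of_ne (hnn i) (Finset.mem_filter.1 i.2).2.symm
      exact Complex.ofReal_ne_zero.2 (Real.sqrt_pos.2 this).ne'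
    simp only [Pi.smul_apply, tensorVec, smul_eq_mul]
    field_simp

theorem IsOrthonormalFamily.tensorVec_dotProduct {ι κ A B : Type*} [DecidableEq ι] [DecidableEq κ]
    [Fintype A] [Fintype B] {u : ι → A → ℂ} {v : κ → B → ℂ} (hu : IsOrthonormalFamily u)
    (hv : IsOrthonormalFamily v) (i j : ι) (k m : κ) :
    star (tensorVec (u i) (v k)) ⬝ᵥ tensorVec (u j) (v m) = if i = j ∧ k = m then 1 else 0 := by
  have : star (tensorVec (u i) (v k)) ⬝ᵥ tensorVec (u j) (v m) =
      (star (u i) ⬝ᵥ u j) * (star (v k) ⬝ᵥ v m) := by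
    simp only [dotProduct, Finset.sum_mul_sum, Fintype.sum_prod_type]
    refine Finset.sum_congr rfl fun a _ => Finset.sum_congr rfl fun b _ => ?_
    simp [tensorVec]; ring
  rw [this, hu, hv, ite_and]
  split_ifs <;> simp

theorem IsSchmidt.isNormalized_iff {ι A B : Type*} [Fintype ι] [DecidableEq ι] [Fintype A]
    [Fintype B] {ψ : A × B → ℂ} {l : ι → ℝ} {u : ι → A → ℂ} {v : ι → B → ℂ}
    (h : IsSchmidt ψ l u v) : IsNormalized ψ ↔ ∑ i, l i = 1 := by
  have hij : ∀ i j, star (tensorVec (u i) (v i)) ⬝ᵥ tensorVec (u j) (v j) =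
      if i = j then 1 else 0 := fun i j => by
    rw [h.left.tensorVec_dotProduct h.right]
    simp only [and_self]
  have h1 : ((∑ p, ‖ψ p‖ ^ 2 : ℝ) : ℂ) = ((∑ i, l i : ℝ) : ℂ) := by
    rw [sum_norm_sq_eq, h.eq_sum, star_sum, sum_dotProduct]
    simp only [dotProduct_sum, star_smul, smul_dotProduct, dotProduct_smul, hij]
    simp only [smul_ite, smul_zero, Finset.sum_ite_eq, Finset.mem_univ, if_true]
    rw [Complex.ofReal_sum]
    refine Finset.sum_congr rfl fun i _ => ?_
    simp only [Complex.star_def, Complex.conj_ofReal, smul_eq_mul, mul_one]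
    rw [← Complex.ofReal_mul, Real.mul_self_sqrt (h.nonneg i)]
  rw [IsNormalized, Complex.ofReal_injective h1]

/-! ### Rates of product Hamiltonians -/

section ProductBound

variable {ι A B : Type*}

theorem isHermitian_kronecker {P : Matrix A A ℂ} (hP : P.IsHermitian) {Q : Matrix B B ℂ}
    (hQ : Q.IsHermitian) : (P ⊗ₖ Q).IsHermitian := by
  rw [Matrix.IsHermitian, Matrix.conjTranspose_kronecker, hP.eq, hQ.eq]

variable [Fintype A] [Fintype B]

theorem matrixElement_kronecker (P : Matrix A A ℂ) (Q : Matrix B B ℂ) (u : ι → A → ℂ)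
    (v : ι → B → ℂ) (i j : ι) :
    matrixElement (P ⊗ₖ Q) u v i j = (star (u i) ⬝ᵥ P *ᵥ u j) * (star (v i) ⬝ᵥ Q *ᵥ v j) := by
  have h : (P ⊗ₖ Q) *ᵥ tensorVec (u j) (v j) = tensorVec (P *ᵥ u j) (Q *ᵥ v j) := by
    funext p
    simp only [Matrix.mulVec, dotProduct, tensorVec, Fintype.sum_prod_type, Finset.sum_mul_sum,
      Matrix.kroneckerMap_apply]
    refine Finset.sum_congr rfl fun a _ => Finset.sum_congr rfl fun b _ => ?_
    ring
  rw [matrixElement, h]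
  simp only [dotProduct, Finset.sum_mul_sum, Fintype.sum_prod_type]
  refine Finset.sum_congr rfl fun a _ => Finset.sum_congr rfl fun b _ => ?_
  simp [tensorVec]; ring

theorem schmidtRate_eq_antisymm [Fintype ι] {H : Matrix (A × B) (A × B) ℂ} (hH : H.IsHermitian)
    (l : ι → ℝ) (u : ι → A → ℂ) (v : ι → B → ℂ) :
    schmidtRate H l u v = -∑ i, ∑ j, √(l i) * √(l j) *
      (Real.logb 2 (l i) - Real.logb 2 (l j)) * (matrixElement H u v i j).im := by
  have h : ∑ i, ∑ j, √(l i) * √(l j) * Real.logb 2 (l j) * (matrixElement H u v i j).im =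
      -∑ i, ∑ j, √(l i) * √(l j) * Real.logb 2 (l i) * (matrixElement H u v i j).im := by
    conv_lhs => rw [Finset.sum_comm]
    simp only [← Finset.sum_neg_distrib]
    refine Finset.sum_congr rfl fun i _ => Finset.sum_congr rfl fun j _ => ?_
    rw [matrixElement_swap hH u v i j, Complex.star_def, Complex.conj_im]
    ring
  simp only [mul_sub, sub_mul, Finset.sum_sub_distrib]
  rw [h, schmidtRate]
  ring

variable [DecidableEq ι]

/-- The off-diagonal part of the matrix of `P` in the family `u`. -/
def offDiagonal (P : Matrix A A ℂ) (u : ι → A → ℂ) (i j : ι) : ℝ :=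
  if i = j then 0 else ‖star (u i) ⬝ᵥ P *ᵥ u j‖

theorem offDiagonal_symm {P : Matrix A A ℂ} (hP : P.IsHermitian) (u : ι → A → ℂ) (i j : ι) :
    offDiagonal P u i j = offDiagonal P u j i := by
  rw [offDiagonal, offDiagonal]
  have : star (u i) ⬝ᵥ P *ᵥ u j = star (star (u j) ⬝ᵥ P *ᵥ u i) := by
    rw [← Matrix.star_dotProduct, Matrix.star_mulVec, hP.eq, Matrix.dotProduct_mulVec]
  rw [this, norm_star]
  simp only [eq_comm]

variable [Fintype ι]

theorem IsOrthonormalFamily.sum_sq_norm_le {u : ι → A → ℂ} (hu : IsOrthonormalFamily u)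
    (w : A → ℂ) : ∑ i, ‖star (u i) ⬝ᵥ w‖ ^ 2 ≤ ∑ a, ‖w a‖ ^ 2 := by
  have hinner : ∀ i (x : A → ℂ), inner ℂ (WithLp.toLp 2 (u i)) (WithLp.toLp 2 x) =
      star (u i) ⬝ᵥ x := fun i x => by
    rw [EuclideanSpace.inner_toLp_toLp, dotProduct_comm]
  have ho : Orthonormal ℂ fun i => WithLp.toLp 2 (u i) := by
    rw [orthonormal_iff_ite]
    intro i j
    rw [hinner, hu]
  have := ho.sum_inner_products_le (s := Finset.univ) (WithLp.toLp 2 w)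
  simpa only [hinner, EuclideanSpace.norm_sq_eq] using this

variable [DecidableEq A] [DecidableEq B]

/-- The spectrum of `P` lies within distance `a` of some real number. -/
def HasSpectralRadiusLE (P : Matrix A A ℂ) (a : ℝ) : Prop :=
  0 ≤ a ∧ ∃ c : ℝ, ∀ w : A → ℂ,
    ∑ i, ‖((P - (c : ℂ) • 1) *ᵥ w) i‖ ^ 2 ≤ a ^ 2 * ∑ i, ‖w i‖ ^ 2

/-- Off-diagonal entries of `P` and `P - c` agree in an orthonormal family, so Bessel's inequality
for `(P - c) u i` applies. -/
theorem sum_sq_offDiagonal_le {P : Matrix A A ℂ} (hP : P.IsHermitian) {a : ℝ}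
    (ha : HasSpectralRadiusLE P a) {u : ι → A → ℂ} (hu : IsOrthonormalFamily u) (i : ι) :
    ∑ j, offDiagonal P u i j ^ 2 ≤ a ^ 2 := by
  obtain ⟨-, c, hc⟩ := ha
  have h1 : ∀ j, offDiagonal P u i j ^ 2 ≤
      ‖star (u j) ⬝ᵥ ((P - (c : ℂ) • 1) *ᵥ u i)‖ ^ 2 := fun j => by
    rw [offDiagonal_symm hP, offDiagonal]
    split_ifs with h
    · simp
    · rw [Matrix.sub_mulVec, Matrix.smul_mulVec, Matrix.one_mulVec, dotProduct_sub,
        dotProduct_smul, hu, if_neg h, smul_zero, sub_zero]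
  have h2 : ∑ b, ‖u i b‖ ^ 2 = 1 := by
    have h := hu i i
    rw [if_pos rfl, ← sum_norm_sq_eq] at h
    exact_mod_cast h
  calc _ ≤ ∑ j, ‖star (u j) ⬝ᵥ ((P - (c : ℂ) • 1) *ᵥ u i)‖ ^ 2 := Finset.sum_le_sum fun j _ => h1 j
    _ ≤ _ := hu.sum_sq_norm_le _
    _ ≤ _ := hc _
    _ = a ^ 2 := by rw [h2, mul_one]

theorem sum_offDiagonal_mul_le {P : Matrix A A ℂ} (hP : P.IsHermitian) {Q : Matrix B B ℂ}
    (hQ : Q.IsHermitian) {a b : ℝ} (ha : HasSpectralRadiusLE P a) (hb : HasSpectralRadiusLE Q b)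
    {u : ι → A → ℂ} (hu : IsOrthonormalFamily u) {v : ι → B → ℂ} (hv : IsOrthonormalFamily v)
    (i : ι) : ∑ j, offDiagonal P u i j * offDiagonal Q v i j ≤ a * b := by
  refine (Real.sum_mul_le_sqrt_mul_sqrt _ _ _).trans ?_
  refine mul_le_mul ?_ ?_ (Real.sqrt_nonneg _) ha.1
  · exact Real.sqrt_le_iff.2 ⟨ha.1, sum_sq_offDiagonal_le hP ha hu i⟩
  · exact Real.sqrt_le_iff.2 ⟨hb.1, sum_sq_offDiagonal_le hQ hb hv i⟩

theorem abs_schmidtRate_kronecker_le {P : Matrix A A ℂ} (hP : P.IsHermitian) {Q : Matrix B B ℂ}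
    (hQ : Q.IsHermitian) {a b : ℝ} (ha : HasSpectralRadiusLE P a) (hb : HasSpectralRadiusLE Q b)
    {ψ : A × B → ℂ} {l : ι → ℝ} {u : ι → A → ℂ} {v : ι → B → ℂ} (h : IsSchmidt ψ l u v)
    (hψ : IsNormalized ψ) : |schmidtRate (P ⊗ₖ Q) l u v| ≤ alpha * a * b := by
  have hl : ∑ i, l i = 1 := h.isNormalized_iff.1 hψ
  -- Diagonal terms vanish with the difference of logarithms, so only off-diagonal matrix elements
  -- matter.
  have hterm : ∀ i j, |√(l i) * √(l j) * (Real.logb 2 (l i) - Real.logb 2 (l j)) *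
      (matrixElement (P ⊗ₖ Q) u v i j).im| ≤
      (l i + l j) * (alpha / 2) * (offDiagonal P u i j * offDiagonal Q v i j) := fun i j => by
    by_cases hij : i = j
    · subst hij; simp [offDiagonal]
    · rw [abs_mul, offDiagonal, offDiagonal, if_neg hij, if_neg hij, ← norm_mul,
        ← matrixElement_kronecker]
      have := alpha_nonneg
      have := h.nonneg i
      have := h.nonneg j
      refine mul_le_mul (abs_sqrt_mul_logb_sub_le (h.nonneg i) (h.nonneg j))
        (Complex.abs_im_le_norm _) (abs_nonneg _) (by positivity)
  have hS : ∑ i, ∑ j, l i * (offDiagonal P u i j * offDiagonal Q v i j) ≤ a * b := by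
    calc _ = ∑ i, l i * ∑ j, offDiagonal P u i j * offDiagonal Q v i j := by
          simp only [Finset.mul_sum]
      _ ≤ ∑ i, l i * (a * b) := Finset.sum_le_sum fun i _ => mul_le_mul_of_nonneg_left
          (sum_offDiagonal_mul_le hP hQ ha hb h.left h.right i) (h.nonneg i)
      _ = a * b := by rw [← Finset.sum_mul, hl, one_mul]
  -- Hermiticity makes the off-diagonal moduli symmetric, so column sums obey the same bound as row
  -- sums.
  have hS' : ∑ i, ∑ j, l j * (offDiagonal P u i j * offDiagonal Q v i j) ≤ a * b := by
    rw [Finset.sum_comm]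
    simpa only [offDiagonal_symm hP u, offDiagonal_symm hQ v] using hS
  rw [schmidtRate_eq_antisymm (isHermitian_kronecker hP hQ), abs_neg]
  calc _ ≤ ∑ i, ∑ j, (l i + l j) * (alpha / 2) * (offDiagonal P u i j * offDiagonal Q v i j) :=
        (Finset.abs_sum_le_sum_abs _ _).trans (Finset.sum_le_sum fun i _ =>
          (Finset.abs_sum_le_sum_abs _ _).trans (Finset.sum_le_sum fun j _ => hterm i j))
    _ = alpha / 2 * (∑ i, ∑ j, l i * (offDiagonal P u i j * offDiagonal Q v i j) +
          ∑ i, ∑ j, l j * (offDiagonal P u i j * offDiagonal Q v i j)) := by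
        simp only [← Finset.sum_add_distrib, Finset.mul_sum]
        refine Finset.sum_congr rfl fun i _ => Finset.sum_congr rfl fun j _ => ?_
        ring
    _ ≤ alpha / 2 * (a * b + a * b) := by
        have := alpha_nonneg
        gcongr
    _ = _ := by ring

end ProductBound

/-! ### Spectral spread -/

section Spread

variable {A : Type*} [Fintype A] [DecidableEq A]

theorem hasSpectralRadiusLE_of_isHermitian [Nonempty A] {M : Matrix A A ℂ} (hM : M.IsHermitian) :
    HasSpectralRadiusLE M (spectralSpread hM / 2) := by
  have hmax : ∀ i, hM.eigenvalues i ≤ maxEigenvalue hM := fun i =>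
    le_ciSup (Set.finite_range hM.eigenvalues).bddAbove i
  have hmin : ∀ i, minEigenvalue hM ≤ hM.eigenvalues i := fun i =>
    ciInf_le (Set.finite_range hM.eigenvalues).bddBelow i
  refine ⟨?_, (maxEigenvalue hM + minEigenvalue hM) / 2, fun w => ?_⟩
  · have i := Classical.arbitrary A
    have := hmax i
    have := hmin i
    rw [spectralSpread]; linarith
  -- The midpoint of the spectrum minimizes the largest distance to an eigenvalue, which becomes
  -- half the spread.
  set c := (maxEigenvalue hM + minEigenvalue hM) / 2 with hc
  have hcoord : ∀ x : A → ℂ, ∑ i, ‖x i‖ ^ 2 =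
      ∑ i, ‖star (⇑(hM.eigenvectorBasis i) : A → ℂ) ⬝ᵥ x‖ ^ 2 := fun x => by
    have := hM.eigenvectorBasis.sum_sq_norm_inner_right (WithLp.toLp 2 x)
    rw [EuclideanSpace.norm_sq_eq] at this
    rw [← this]
    refine Finset.sum_congr rfl fun i _ => ?_
    rw [EuclideanSpace.inner_eq_star_dotProduct, dotProduct_comm]
  rw [hcoord ((M - (c : ℂ) • 1) *ᵥ w), hcoord w, Finset.mul_sum]
  refine Finset.sum_le_sum fun i _ => ?_
  have h1 : star (⇑(hM.eigenvectorBasis i) : A → ℂ) ⬝ᵥ ((M - (c : ℂ) • 1) *ᵥ w) =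
      ((hM.eigenvalues i - c : ℝ) : ℂ) * (star (⇑(hM.eigenvectorBasis i) : A → ℂ) ⬝ᵥ w) := by
    have h2 : star (⇑(hM.eigenvectorBasis i) : A → ℂ) ⬝ᵥ (M *ᵥ w) =
        (hM.eigenvalues i : ℂ) * (star (⇑(hM.eigenvectorBasis i) : A → ℂ) ⬝ᵥ w) := by
      have h3 (x : A → ℂ) : star x ᵥ* M = star (M *ᵥ x) := by rw [Matrix.star_mulVec, hM.eq]
      rw [Matrix.dotProduct_mulVec, h3, hM.mulVec_eigenvectorBasis, star_smul, smul_dotProduct]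
      simp
    rw [Matrix.sub_mulVec, dotProduct_sub, h2, Matrix.smul_mulVec, Matrix.one_mulVec,
      dotProduct_smul, smul_eq_mul]
    push_cast; ring
  rw [h1, norm_mul, mul_pow, Complex.norm_real, Real.norm_eq_abs]
  refine mul_le_mul_of_nonneg_right (pow_le_pow_left₀ (abs_nonneg _) (abs_le.2 ?_) 2) (sq_nonneg _)
  have := hmax i
  have := hmin i
  rw [spectralSpread]
  constructor <;> linarith

theorem HasSpectralRadiusLE.kronecker_one {C : Type*} [Fintype C] [DecidableEq C]
    {P : Matrix A A ℂ} {a : ℝ} (h : HasSpectralRadiusLE P a) :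
    HasSpectralRadiusLE (P ⊗ₖ (1 : Matrix C C ℂ)) a := by
  obtain ⟨ha, c, hc⟩ := h
  refine ⟨ha, c, fun w => ?_⟩
  have h1 : ∀ i k, ((P ⊗ₖ (1 : Matrix C C ℂ) - (c : ℂ) • 1) *ᵥ w) (i, k) =
      ((P - (c : ℂ) • 1) *ᵥ fun i => w (i, k)) i := fun i k => by
    rw [Matrix.sub_mulVec, Matrix.sub_mulVec, Matrix.smul_mulVec, Matrix.smul_mulVec,
      Matrix.one_mulVec, Matrix.one_mulVec]
    simp [Matrix.mulVec, dotProduct, Fintype.sum_prod_type, Matrix.one_apply]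
  simp only [Fintype.sum_prod_type_right, h1, Finset.mul_sum]
  refine Finset.sum_le_sum fun k _ => ?_
  simpa only [Finset.mul_sum] using hc fun i => w (i, k)

theorem HasSpectralRadiusLE.one_kronecker {C : Type*} [Fintype C] [DecidableEq C]
    {P : Matrix A A ℂ} {a : ℝ} (h : HasSpectralRadiusLE P a) :
    HasSpectralRadiusLE ((1 : Matrix C C ℂ) ⊗ₖ P) a := by
  obtain ⟨ha, c, hc⟩ := h
  refine ⟨ha, c, fun w => ?_⟩
  have h1 : ∀ k i, (((1 : Matrix C C ℂ) ⊗ₖ P - (c : ℂ) • 1) *ᵥ w) (k, i) =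
      ((P - (c : ℂ) • 1) *ᵥ fun i => w (k, i)) i := fun k i => by
    rw [Matrix.sub_mulVec, Matrix.sub_mulVec, Matrix.smul_mulVec, Matrix.smul_mulVec,
      Matrix.one_mulVec, Matrix.one_mulVec]
    simp [Matrix.mulVec, dotProduct, Fintype.sum_prod_type, Matrix.one_apply, Finset.sum_ite_eq]
  simp only [Fintype.sum_prod_type, h1, Finset.mul_sum]
  refine Finset.sum_le_sum fun k _ => ?_
  simpa only [Finset.mul_sum] using hc fun i => w (k, i)

end Spread

/-! ### Sums of Hamiltonians on different pairs of systems -/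

/-- The product of a state of `A₁B₁` and a state of `A₂B₂`, as a state of `(A₁A₂)(B₁B₂)`. -/
def prodState {A₁ B₁ A₂ B₂ : Type*} (ψ₁ : A₁ × B₁ → ℂ) (ψ₂ : A₂ × B₂ → ℂ) :
    (A₁ × A₂) × (B₁ × B₂) → ℂ :=
  tensorVec ψ₁ ψ₂ ∘ Equiv.prodProdProdComm A₁ A₂ B₁ B₂

theorem boxSum_kronecker {A₁ B₁ A₂ B₂ : Type*} [DecidableEq A₁] [DecidableEq B₁] [DecidableEq A₂]
    [DecidableEq B₂] (P₁ : Matrix A₁ A₁ ℂ) (Q₁ : Matrix B₁ B₁ ℂ) (P₂ : Matrix A₂ A₂ ℂ)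
    (Q₂ : Matrix B₂ B₂ ℂ) :
    boxSum (P₁ ⊗ₖ Q₁) (P₂ ⊗ₖ Q₂) =
      (P₁ ⊗ₖ (1 : Matrix A₂ A₂ ℂ)) ⊗ₖ (Q₁ ⊗ₖ (1 : Matrix B₂ B₂ ℂ)) +
      ((1 : Matrix A₁ A₁ ℂ) ⊗ₖ P₂) ⊗ₖ ((1 : Matrix B₁ B₁ ℂ) ⊗ₖ Q₂) := by
  ext ⟨⟨a₁, a₂⟩, b₁, b₂⟩ ⟨⟨a₁', a₂'⟩, b₁', b₂'⟩
  simp only [boxSum, Matrix.submatrix_apply, Matrix.add_apply, Matrix.kroneckerMap_apply,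
    Equiv.prodProdProdComm_apply, Matrix.one_apply, Prod.mk.injEq, ite_and]
  split_ifs <;> simp

theorem withAncillas_eq_boxSum {A B : Type*} [DecidableEq A] [DecidableEq B] (A' B' : Type*)
    [DecidableEq A'] [DecidableEq B'] (H : Matrix (A × B) (A × B) ℂ) :
    withAncillas A' B' H = boxSum H 0 := by
  simp [withAncillas, boxSum]

theorem boxSum_isHermitian {A₁ B₁ A₂ B₂ : Type*} [DecidableEq A₁] [DecidableEq B₁] [DecidableEq A₂]
    [DecidableEq B₂] {H₁ : Matrix (A₁ × B₁) (A₁ × B₁) ℂ} {H₂ : Matrix (A₂ × B₂) (A₂ × B₂) ℂ}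
    (h₁ : H₁.IsHermitian) (h₂ : H₂.IsHermitian) : (boxSum H₁ H₂).IsHermitian :=
  ((isHermitian_kronecker h₁ Matrix.isHermitian_one).add
    (isHermitian_kronecker Matrix.isHermitian_one h₂)).submatrix _

theorem matrixElement_add {ι A B : Type*} [Fintype A] [Fintype B]
    (H K : Matrix (A × B) (A × B) ℂ) (u : ι → A → ℂ) (v : ι → B → ℂ) (i j : ι) :
    matrixElement (H + K) u v i j = matrixElement H u v i j + matrixElement K u v i j := by
  rw [matrixElement, Matrix.add_mulVec, dotProduct_add]; rfl

theorem schmidtRate_add {ι A B : Type*} [Fintype ι] [Fintype A] [Fintype B]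
    (H K : Matrix (A × B) (A × B) ℂ) (l : ι → ℝ) (u : ι → A → ℂ) (v : ι → B → ℂ) :
    schmidtRate (H + K) l u v = schmidtRate H l u v + schmidtRate K l u v := by
  simp only [schmidtRate, matrixElement_add, Complex.add_im, mul_add, Finset.sum_add_distrib]
  ring

/-- The logarithm of `l i * m k` splits. The `log (m k)` part multiplies the double sum assumed to
vanish in `hX`, and the `log (l i)` part is averaged with total weight one. -/
theorem sum_sqrt_mul_logb_mul {ι κ : Type*} [Fintype ι] [Fintype κ] [DecidableEq κ]
    {l : ι → ℝ} {m : κ → ℝ} (hl : ∀ i, 0 < l i) (hm : ∀ k, 0 < m k)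
    (hm1 : ∑ k, m k = 1) {X : ι → ι → ℝ} (hX : ∑ i, ∑ j, √(l i) * √(l j) * X i j = 0) :
    ∑ p : ι × κ, ∑ q : ι × κ, √(l p.1 * m p.2) * √(l q.1 * m q.2) * Real.logb 2 (l p.1 * m p.2) *
      (if p.2 = q.2 then X p.1 q.1 else 0) =
    ∑ i, ∑ j, √(l i) * √(l j) * Real.logb 2 (l i) * X i j := by
  have h1 : ∀ i k, ∑ q : ι × κ, √(l i * m k) * √(l q.1 * m q.2) * Real.logb 2 (l i * m k) *
      (if k = q.2 then X i q.1 else 0) =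
      m k * ∑ j, √(l i) * √(l j) * Real.logb 2 (l i) * X i j +
        m k * Real.logb 2 (m k) * ∑ j, √(l i) * √(l j) * X i j := fun i k => by
    rw [Fintype.sum_prod_type]
    simp only [mul_ite, mul_zero, Finset.sum_ite_eq, Finset.mem_univ, if_true]
    rw [Finset.mul_sum, Finset.mul_sum, ← Finset.sum_add_distrib]
    refine Finset.sum_congr rfl fun j _ => ?_
    have h2 := Real.mul_self_sqrt (hm k).le
    rw [Real.sqrt_mul (hl i).le, Real.sqrt_mul (hl j).le, Real.logb_mul (hl i).ne' (hm k).ne']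
    calc _ = (√(m k) * √(m k)) * (√(l i) * √(l j) * (Real.logb 2 (l i) + Real.logb 2 (m k)) *
          X i j) := by ring
      _ = _ := by rw [h2]; ring
  rw [Fintype.sum_prod_type]
  simp only [h1, Finset.sum_add_distrib, ← Finset.sum_mul, hm1, one_mul]
  rw [← Finset.mul_sum, hX, mul_zero, add_zero]

section BoxSum

variable {ι κ A₁ B₁ A₂ B₂ : Type*}

theorem tensorVec_tensorVec (u₁ : A₁ → ℂ) (v₁ : B₁ → ℂ) (u₂ : A₂ → ℂ) (v₂ : B₂ → ℂ) :
    tensorVec (tensorVec u₁ u₂) (tensorVec v₁ v₂) =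
      prodState (tensorVec u₁ v₁) (tensorVec u₂ v₂) := by
  funext p
  simp only [tensorVec, prodState, Function.comp, Equiv.prodProdProdComm_apply]
  ring

variable [Fintype A₁] [Fintype B₁] [Fintype A₂] [Fintype B₂]

theorem isNormalized_prodState {ψ₁ : A₁ × B₁ → ℂ} {ψ₂ : A₂ × B₂ → ℂ} (h₁ : IsNormalized ψ₁)
    (h₂ : IsNormalized ψ₂) : IsNormalized (prodState ψ₁ ψ₂) := by
  have h : ∑ p, ‖prodState ψ₁ ψ₂ p‖ ^ 2 = ∑ p, ‖tensorVec ψ₁ ψ₂ p‖ ^ 2 :=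
    Fintype.sum_equiv (Equiv.prodProdProdComm A₁ A₂ B₁ B₂) _ _ fun p => rfl
  rw [IsNormalized, h, Fintype.sum_prod_type]
  simp only [tensorVec, norm_mul, mul_pow]
  rw [← Finset.sum_mul_sum, h₁, h₂, mul_one]

variable {u₁ : ι → A₁ → ℂ} {v₁ : ι → B₁ → ℂ} {u₂ : κ → A₂ → ℂ} {v₂ : κ → B₂ → ℂ}

variable [DecidableEq ι] [DecidableEq κ]

theorem IsOrthonormalFamily.tensor {A B : Type*} [Fintype A] [Fintype B] {u : ι → A → ℂ}
    {v : κ → B → ℂ} (hu : IsOrthonormalFamily u) (hv : IsOrthonormalFamily v) :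
    IsOrthonormalFamily fun p : ι × κ => tensorVec (u p.1) (v p.2) := fun p q => by
  rw [hu.tensorVec_dotProduct hv]
  simp only [Prod.ext_iff]

theorem IsSchmidt.prodState [Fintype ι] [Fintype κ] {ψ₁ : A₁ × B₁ → ℂ}
    {ψ₂ : A₂ × B₂ → ℂ} {l : ι → ℝ} {m : κ → ℝ}
    (h₁ : IsSchmidt ψ₁ l u₁ v₁) (h₂ : IsSchmidt ψ₂ m u₂ v₂) :
    IsSchmidt (prodState ψ₁ ψ₂) (fun p : ι × κ => l p.1 * m p.2)
      (fun p => tensorVec (u₁ p.1) (u₂ p.2)) (fun p => tensorVec (v₁ p.1) (v₂ p.2)) where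
  nonneg p := mul_nonneg (h₁.nonneg _) (h₂.nonneg _)
  left := h₁.left.tensor h₂.left
  right := h₁.right.tensor h₂.right
  eq_sum := by
    funext p
    simp only [Fintype.sum_prod_type, Finset.sum_apply, Pi.smul_apply,
      BipartiteEntanglement.prodState, Function.comp, smul_eq_mul]
    conv_lhs => rw [h₁.eq_sum, h₂.eq_sum]
    simp only [tensorVec, Equiv.prodProdProdComm_apply, Finset.sum_apply, Pi.smul_apply,
      smul_eq_mul, Finset.sum_mul_sum]
    refine Finset.sum_congr rfl fun i _ => Finset.sum_congr rfl fun k _ => ?_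
    rw [Real.sqrt_mul (h₁.nonneg i), Complex.ofReal_mul]
    ring

variable [DecidableEq A₁] [DecidableEq B₁] [DecidableEq A₂] [DecidableEq B₂]

theorem matrixElement_boxSum (H₁ : Matrix (A₁ × B₁) (A₁ × B₁) ℂ)
    (H₂ : Matrix (A₂ × B₂) (A₂ × B₂) ℂ) (hu₁ : IsOrthonormalFamily u₁)
    (hv₁ : IsOrthonormalFamily v₁) (hu₂ : IsOrthonormalFamily u₂) (hv₂ : IsOrthonormalFamily v₂)
    (p q : ι × κ) :
    matrixElement (boxSum H₁ H₂) (fun p : ι × κ => tensorVec (u₁ p.1) (u₂ p.2))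
      (fun p : ι × κ => tensorVec (v₁ p.1) (v₂ p.2)) p q =
    (if p.2 = q.2 then matrixElement H₁ u₁ v₁ p.1 q.1 else 0) +
      (if p.1 = q.1 then matrixElement H₂ u₂ v₂ p.2 q.2 else 0) := by
  set e := Equiv.prodProdProdComm A₁ A₂ B₁ B₂
  set T₁ : ι × κ → A₁ × B₁ → ℂ := fun p => tensorVec (u₁ p.1) (v₁ p.1)
  set T₂ : ι × κ → A₂ × B₂ → ℂ := fun p => tensorVec (u₂ p.2) (v₂ p.2)
  have h1 : matrixElement (boxSum H₁ H₂) (fun p : ι × κ => tensorVec (u₁ p.1) (u₂ p.2))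
      (fun p : ι × κ => tensorVec (v₁ p.1) (v₂ p.2)) p q =
      matrixElement (H₁ ⊗ₖ (1 : Matrix (A₂ × B₂) (A₂ × B₂) ℂ) +
        (1 : Matrix (A₁ × B₁) (A₁ × B₁) ℂ) ⊗ₖ H₂) T₁ T₂ p q := by
    rw [matrixElement, tensorVec_tensorVec, tensorVec_tensorVec, boxSum,
      Matrix.submatrix_mulVec_equiv]
    have h2 : prodState (tensorVec (u₁ q.1) (v₁ q.1)) (tensorVec (u₂ q.2) (v₂ q.2)) ∘ e.symm =
        tensorVec (T₁ q) (T₂ q) := by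
      funext x; simp [prodState, T₁, T₂, e]
    rw [h2]
    exact Fintype.sum_equiv e _ _ fun x => rfl
  rw [h1, matrixElement_add, matrixElement_kronecker, matrixElement_kronecker, Matrix.one_mulVec,
    Matrix.one_mulVec, hu₁.tensorVec_dotProduct hv₁, hu₂.tensorVec_dotProduct hv₂]
  simp only [and_self, mul_ite, ite_mul, mul_one, one_mul, mul_zero, zero_mul]
  rfl

theorem schmidtRate_boxSum [Fintype ι] [Fintype κ]
    {H₁ : Matrix (A₁ × B₁) (A₁ × B₁) ℂ} {H₂ : Matrix (A₂ × B₂) (A₂ × B₂) ℂ}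
    (hH₁ : H₁.IsHermitian) (hH₂ : H₂.IsHermitian) {l : ι → ℝ} {m : κ → ℝ} (hl : ∀ i, 0 < l i)
    (hm : ∀ k, 0 < m k) (hl1 : ∑ i, l i = 1) (hm1 : ∑ k, m k = 1) (hu₁ : IsOrthonormalFamily u₁)
    (hv₁ : IsOrthonormalFamily v₁) (hu₂ : IsOrthonormalFamily u₂) (hv₂ : IsOrthonormalFamily v₂) :
    schmidtRate (boxSum H₁ H₂) (fun p : ι × κ => l p.1 * m p.2)
      (fun p => tensorVec (u₁ p.1) (u₂ p.2)) (fun p => tensorVec (v₁ p.1) (v₂ p.2)) =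
    schmidtRate H₁ l u₁ v₁ + schmidtRate H₂ m u₂ v₂ := by
  have h1 := sum_sqrt_mul_logb_mul hl hm hm1 (sum_sqrt_mul_im_matrixElement hH₁ l u₁ v₁)
  have h2 := sum_sqrt_mul_logb_mul hm hl hl1 (sum_sqrt_mul_im_matrixElement hH₂ m u₂ v₂)
  have h3 : ∑ p : ι × κ, ∑ q : ι × κ, √(l p.1 * m p.2) * √(l q.1 * m q.2) *
      Real.logb 2 (l p.1 * m p.2) *
        (if p.1 = q.1 then (matrixElement H₂ u₂ v₂ p.2 q.2).im else 0) =
      ∑ i, ∑ j, √(m i) * √(m j) * Real.logb 2 (m i) * (matrixElement H₂ u₂ v₂ i j).im := by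
    rw [← h2]
    refine Fintype.sum_equiv (Equiv.prodComm ι κ) _ _ fun p =>
      Fintype.sum_equiv (Equiv.prodComm ι κ) _ _ fun q => ?_
    simp only [Equiv.prodComm_apply, Prod.fst_swap, Prod.snd_swap, mul_comm (m _) (l _)]
    rfl
  simp only [schmidtRate, matrixElement_boxSum H₁ H₂ hu₁ hv₁ hu₂ hv₂, Complex.add_im, mul_add,
    Finset.sum_add_distrib, apply_ite Complex.im, Complex.zero_im]
  rw [h1, h3]
  ring

end BoxSum

/-! ### Entanglement rates -/

section Rates

variable {A B : Type*} [Fintype A] [DecidableEq A] [Fintype B] [DecidableEq B]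

theorem IsSchmidt.entanglementRate_eq {ι : Type*} [Fintype ι] [DecidableEq ι]
    {H : Matrix (A × B) (A × B) ℂ} (hH : H.IsHermitian) {ψ : A × B → ℂ} {l : ι → ℝ}
    {u : ι → A → ℂ} {v : ι → B → ℂ} (h : IsSchmidt ψ l u v) :
    entanglementRate H ψ = schmidtRate H l u v :=
  (hasDerivAt_entanglement hH h).deriv

theorem differentiableAt_entanglement {H : Matrix (A × B) (A × B) ℂ} (hH : H.IsHermitian)
    (ψ : A × B → ℂ) : DifferentiableAt ℝ (fun t : ℝ => entanglement (evolve H t ψ)) 0 := by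
  obtain ⟨s, l, u, v, h, -⟩ := exists_isSchmidt ψ
  exact (hasDerivAt_entanglement hH h).differentiableAt

/-- A Schmidt decomposition depends only on the state, so one serves both Hamiltonians, and the rate
formula is linear in the matrix elements. -/
theorem entanglementRate_add {H K : Matrix (A × B) (A × B) ℂ} (hH : H.IsHermitian)
    (hK : K.IsHermitian) (ψ : A × B → ℂ) :
    entanglementRate (H + K) ψ = entanglementRate H ψ + entanglementRate K ψ := by
  obtain ⟨s, l, u, v, h, -⟩ := exists_isSchmidt ψ
  rw [h.entanglementRate_eq hH, h.entanglementRate_eq hK, h.entanglementRate_eq (hH.add hK),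
    schmidtRate_add]

theorem entanglementRate_zero (ψ : A × B → ℂ) :
    entanglementRate (0 : Matrix (A × B) (A × B) ℂ) ψ = 0 := by
  simp [entanglementRate, evolve]

theorem abs_entanglementRate_kronecker_le {P : Matrix A A ℂ} (hP : P.IsHermitian)
    {Q : Matrix B B ℂ} (hQ : Q.IsHermitian) {a b : ℝ} (ha : HasSpectralRadiusLE P a)
    (hb : HasSpectralRadiusLE Q b) {ψ : A × B → ℂ} (hψ : IsNormalized ψ) :
    |entanglementRate (P ⊗ₖ Q) ψ| ≤ alpha * a * b := by
  obtain ⟨s, l, u, v, h, -⟩ := exists_isSchmidt ψ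
  rw [h.entanglementRate_eq (isHermitian_kronecker hP hQ)]
  exact abs_schmidtRate_kronecker_le hP hQ ha hb h hψ

theorem exists_isNormalized {ι : Type*} [Fintype ι] [DecidableEq ι] [Nonempty ι] :
    ∃ ψ : ι → ℂ, IsNormalized ψ := by
  refine ⟨Pi.single (Classical.arbitrary ι) 1, ?_⟩
  rw [IsNormalized, Finset.sum_eq_single (Classical.arbitrary ι)] <;> simp +contextual

theorem entanglementCapability_eq_of_isGreatest {H : Matrix (A × B) (A × B) ℂ} {r : ℝ}
    (h : IsGreatest (entanglementRates H) r) : entanglementCapability H = r :=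
  h.csSup_eq

end Rates

section BoxSum

variable {A₁ B₁ A₂ B₂ : Type*} [Fintype A₁] [Fintype B₁] [Fintype A₂] [Fintype B₂]
  [DecidableEq A₁] [DecidableEq B₁] [DecidableEq A₂] [DecidableEq B₂]

theorem entanglementRate_boxSum_prodState {H₁ : Matrix (A₁ × B₁) (A₁ × B₁) ℂ}
    {H₂ : Matrix (A₂ × B₂) (A₂ × B₂) ℂ} (hH₁ : H₁.IsHermitian) (hH₂ : H₂.IsHermitian)
    {ψ₁ : A₁ × B₁ → ℂ} {ψ₂ : A₂ × B₂ → ℂ} (h₁ : IsNormalized ψ₁) (h₂ : IsNormalized ψ₂) :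
    entanglementRate (boxSum H₁ H₂) (prodState ψ₁ ψ₂) =
      entanglementRate H₁ ψ₁ + entanglementRate H₂ ψ₂ := by
  obtain ⟨s, l, u₁, v₁, hs, hl⟩ := exists_isSchmidt ψ₁
  obtain ⟨t, m, u₂, v₂, ht, hm⟩ := exists_isSchmidt ψ₂
  rw [(hs.prodState ht).entanglementRate_eq (boxSum_isHermitian hH₁ hH₂),
    hs.entanglementRate_eq hH₁, ht.entanglementRate_eq hH₂]
  exact schmidtRate_boxSum hH₁ hH₂ hl hm (hs.isNormalized_iff.1 h₁) (ht.isNormalized_iff.1 h₂)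
    hs.left hs.right ht.left ht.right

/-- Each summand is itself a product Hamiltonian across the cut between Alice and Bob, with local
factors of unchanged spectral radius; this holds even for states entangled between the two pairs. -/
theorem abs_entanglementRate_boxSum_le {P₁ : Matrix A₁ A₁ ℂ} {Q₁ : Matrix B₁ B₁ ℂ}
    {P₂ : Matrix A₂ A₂ ℂ} {Q₂ : Matrix B₂ B₂ ℂ} (hP₁ : P₁.IsHermitian) (hQ₁ : Q₁.IsHermitian)
    (hP₂ : P₂.IsHermitian) (hQ₂ : Q₂.IsHermitian) {a₁ b₁ a₂ b₂ : ℝ}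
    (ha₁ : HasSpectralRadiusLE P₁ a₁) (hb₁ : HasSpectralRadiusLE Q₁ b₁)
    (ha₂ : HasSpectralRadiusLE P₂ a₂) (hb₂ : HasSpectralRadiusLE Q₂ b₂)
    {ψ : (A₁ × A₂) × (B₁ × B₂) → ℂ} (hψ : IsNormalized ψ) :
    |entanglementRate (boxSum (P₁ ⊗ₖ Q₁) (P₂ ⊗ₖ Q₂)) ψ| ≤ alpha * a₁ * b₁ + alpha * a₂ * b₂ := by
  have hA₁ : (P₁ ⊗ₖ (1 : Matrix A₂ A₂ ℂ)).IsHermitian :=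
    isHermitian_kronecker hP₁ Matrix.isHermitian_one
  have hB₁ : (Q₁ ⊗ₖ (1 : Matrix B₂ B₂ ℂ)).IsHermitian :=
    isHermitian_kronecker hQ₁ Matrix.isHermitian_one
  have hA₂ : ((1 : Matrix A₁ A₁ ℂ) ⊗ₖ P₂).IsHermitian :=
    isHermitian_kronecker Matrix.isHermitian_one hP₂
  have hB₂ : ((1 : Matrix B₁ B₁ ℂ) ⊗ₖ Q₂).IsHermitian :=
    isHermitian_kronecker Matrix.isHermitian_one hQ₂
  rw [boxSum_kronecker, entanglementRate_add (isHermitian_kronecker hA₁ hB₁)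
    (isHermitian_kronecker hA₂ hB₂)]
  exact (abs_add_le _ _).trans (add_le_add
    (abs_entanglementRate_kronecker_le hA₁ hB₁ ha₁.kronecker_one hb₁.kronecker_one hψ)
    (abs_entanglementRate_kronecker_le hA₂ hB₂ ha₂.one_kronecker hb₂.one_kronecker hψ))

end BoxSum

/-! ### An optimal state -/

theorem isingRate_eq_logb_sub {x : ℝ} (hx : x ∈ Set.Icc (0 : ℝ) 1) :
    isingRate x = 2 * (√x * √(1 - x) * (Real.logb 2 x - Real.logb 2 (1 - x))) := by
  obtain ⟨h0, h1⟩ := hx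
  rcases h0.eq_or_lt with rfl | h0
  · simp [isingRate]
  rcases h1.eq_or_lt with rfl | h1
  · simp [isingRate]
  simpa using isingRate_div_add h0 (sub_pos.2 h1)

section Optimal

theorem isNormalized_iff_dotProduct {A : Type*} [Fintype A] {w : A → ℂ} :
    IsNormalized w ↔ star w ⬝ᵥ w = 1 := by
  rw [← sum_norm_sq_eq, IsNormalized]
  norm_cast

theorem one_div_sqrt_two_mul_self :
    ((1 / √2 : ℝ) : ℂ) * ((1 / √2 : ℝ) : ℂ) = 1 / 2 := by
  rw [← Complex.ofReal_mul, div_mul_div_comm, Real.mul_self_sqrt zero_le_two]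
  norm_num

variable {A B : Type*} [Fintype A] [DecidableEq A] [Fintype B] [DecidableEq B]
  {M : Matrix A A ℂ} {hM : M.IsHermitian} {e f : A → ℂ}

theorem IsExtremalPair.dotProducts (h : IsExtremalPair hM e f) :
    star e ⬝ᵥ e = 1 ∧ star f ⬝ᵥ f = 1 ∧ star e ⬝ᵥ f = 0 ∧ star f ⬝ᵥ e = 0 := by
  have hef : star e ⬝ᵥ f = 0 := h.orthogonal
  refine ⟨isNormalized_iff_dotProduct.1 h.normalized_max,
    isNormalized_iff_dotProduct.1 h.normalized_min, hef, ?_⟩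
  rw [Matrix.star_dotProduct, hef, star_zero]

theorem IsExtremalPair.isOrthonormalFamily (h : IsExtremalPair hM e f) :
    IsOrthonormalFamily ![plusVec e f, minusVec e f] := by
  obtain ⟨h1, h2, h3, h4⟩ := h.dotProducts
  have h5 := one_div_sqrt_two_mul_self
  intro i j
  fin_cases i <;> fin_cases j <;>
  · simp [plusVec, minusVec, star_smul, smul_dotProduct, dotProduct_smul, add_dotProduct,
      sub_dotProduct, dotProduct_add, dotProduct_sub, h1, h2, h3, h4] at h5 ⊢
    try linear_combination 2 * h5

theorem IsExtremalPair.plusVec_dotProduct_minusVec (h : IsExtremalPair hM e f) :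
    star (plusVec e f) ⬝ᵥ M *ᵥ minusVec e f = ((spectralSpread hM / 2 : ℝ) : ℂ) := by
  obtain ⟨h1, h2, h3, h4⟩ := h.dotProducts
  have h5 := one_div_sqrt_two_mul_self
  have hc : star ((1 / √2 : ℝ) : ℂ) = ((1 / √2 : ℝ) : ℂ) := by
    rw [Complex.star_def, Complex.conj_ofReal]
  rw [plusVec, minusVec, Matrix.mulVec_smul, Matrix.mulVec_sub, h.eigen_max, h.eigen_min,
    star_smul, hc, smul_dotProduct, dotProduct_smul, smul_smul, h5]
  simp only [star_add, add_dotProduct, dotProduct_sub, dotProduct_smul, h1, h2, h3, h4,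
    spectralSpread, smul_eq_mul]
  push_cast
  ring

/-- The phase `-i` is absorbed into Bob's second vector. It makes the cross matrix element of the
product Hamiltonian purely imaginary, so that all of its modulus contributes to the rate. -/
theorem IsExtremalPair.isSchmidt_optimalInput (h : IsExtremalPair hM e f) {N : Matrix B B ℂ}
    {hN : N.IsHermitian} {e' f' : B → ℂ} (h' : IsExtremalPair hN e' f') {x : ℝ}
    (hx : x ∈ Set.Icc (0 : ℝ) 1) :
    IsSchmidt (optimalInput x e f e' f') ![x, 1 - x] ![plusVec e f, minusVec e f]
      ![plusVec e' f', -Complex.I • minusVec e' f'] where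
  nonneg i := by
    fin_cases i
    · exact hx.1
    · exact sub_nonneg.2 hx.2
  left := h.isOrthonormalFamily
  right i j := by
    have := h'.isOrthonormalFamily i j
    fin_cases i <;> fin_cases j <;>
      simpa [smul_dotProduct, dotProduct_smul, ← mul_assoc] using this
  eq_sum := by
    funext p
    simp only [optimalInput, Fin.sum_univ_two, Pi.sub_apply, Pi.add_apply, Pi.smul_apply,
      tensorVec, Matrix.cons_val_zero, Matrix.cons_val_one, smul_eq_mul]
    ring

theorem IsExtremalPair.optimalInput_spec (h : IsExtremalPair hM e f) {N : Matrix B B ℂ}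
    {hN : N.IsHermitian} {e' f' : B → ℂ} (h' : IsExtremalPair hN e' f') {x : ℝ}
    (hx : x ∈ Set.Icc (0 : ℝ) 1) :
    IsNormalized (optimalInput x e f e' f') ∧
      entanglementRate (M ⊗ₖ N) (optimalInput x e f e' f') =
        isingRate x / 4 * spectralSpread hM * spectralSpread hN := by
  have hS := h.isSchmidt_optimalInput h' hx
  have hH := isHermitian_kronecker hM hN
  refine ⟨hS.isNormalized_iff.2 (by simp), ?_⟩
  rw [hS.entanglementRate_eq hH, schmidtRate_eq_antisymm hH]
  simp only [Fin.sum_univ_two, sub_self, mul_zero, zero_mul, zero_add, add_zero]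
  rw [matrixElement_swap hH _ _ 0 1, matrixElement_kronecker]
  simp only [Matrix.cons_val_zero, Matrix.cons_val_one, Matrix.mulVec_smul, dotProduct_smul,
    h.plusVec_dotProduct_minusVec, h'.plusVec_dotProduct_minusVec, isingRate_eq_logb_sub hx]
  simp
  ring

theorem exists_isExtremalPair [Nonempty A] (hM : M.IsHermitian) (h : spectralSpread hM ≠ 0) :
    ∃ e f, IsExtremalPair hM e f := by
  obtain ⟨i, hi⟩ := exists_eq_ciSup_of_finite (f := hM.eigenvalues)
  obtain ⟨j, hj⟩ := exists_eq_ciInf_of_finite (f := hM.eigenvalues)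
  have hij : i ≠ j := by
    rintro rfl
    rw [spectralSpread, maxEigenvalue, minEigenvalue, ← hi, ← hj, sub_self] at h
    exact h rfl
  have ho : ∀ i j, star (⇑(hM.eigenvectorBasis i) : A → ℂ) ⬝ᵥ ⇑(hM.eigenvectorBasis j) =
      if i = j then 1 else 0 := fun i j => by
    rw [← orthonormal_iff_ite.1 hM.eigenvectorBasis.orthonormal i j,
      EuclideanSpace.inner_eq_star_dotProduct, dotProduct_comm]
  refine ⟨_, _, isNormalized_iff_dotProduct.2 ((ho i i).trans (if_pos rfl)),
    isNormalized_iff_dotProduct.2 ((ho j j).trans (if_pos rfl)), (ho i j).trans (if_neg hij),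
    ?_, ?_⟩
  · rw [hM.mulVec_eigenvectorBasis, maxEigenvalue, ← hi]; rfl
  · rw [hM.mulVec_eigenvectorBasis, minEigenvalue, ← hj]; rfl

theorem exists_entanglementRate_eq [Nonempty A] [Nonempty B] (hM : M.IsHermitian)
    {N : Matrix B B ℂ} (hN : N.IsHermitian) :
    ∃ ψ : A × B → ℂ, IsNormalized ψ ∧
      entanglementRate (M ⊗ₖ N) ψ = alpha / 4 * spectralSpread hM * spectralSpread hN := by
  -- With a zero spread the upper bound forces every rate to vanish, so any state works. Otherwise
  -- the extremal eigenvalues differ on both sides and extremal pairs exist.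
  by_cases h : spectralSpread hM * spectralSpread hN = 0
  · obtain ⟨ψ, hψ⟩ := exists_isNormalized (ι := A × B)
    refine ⟨ψ, hψ, ?_⟩
    have := abs_entanglementRate_kronecker_le hM hN (hasSpectralRadiusLE_of_isHermitian hM)
      (hasSpectralRadiusLE_of_isHermitian hN) hψ
    rw [show alpha * (spectralSpread hM / 2) * (spectralSpread hN / 2) =
      alpha / 4 * (spectralSpread hM * spectralSpread hN) by ring, h, mul_zero] at this
    rw [mul_assoc, h, mul_zero]
    exact abs_nonpos_iff.1 this
  · obtain ⟨e, f, hef⟩ := exists_isExtremalPair hM (left_ne_zero_of_mul h)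
    obtain ⟨e', f', hef'⟩ := exists_isExtremalPair hN (right_ne_zero_of_mul h)
    obtain ⟨x, hx, hmax⟩ := exists_isMaxOn_isingRate
    obtain ⟨h1, h2⟩ := hef.optimalInput_spec hef' hx
    exact ⟨_, h1, by rw [h2, alpha_eq_of_isMaxOn hx hmax]⟩

theorem isGreatest_entanglementRates_kronecker [Nonempty A] [Nonempty B] (hM : M.IsHermitian)
    {N : Matrix B B ℂ} (hN : N.IsHermitian) :
    IsGreatest (entanglementRates (M ⊗ₖ N))
      (alpha / 4 * spectralSpread hM * spectralSpread hN) := by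
  obtain ⟨ψ, hψ, h⟩ := exists_entanglementRate_eq hM hN
  refine ⟨⟨ψ, hψ, h.symm⟩, ?_⟩
  rintro _ ⟨φ, hφ, rfl⟩
  have := abs_entanglementRate_kronecker_le hM hN (hasSpectralRadiusLE_of_isHermitian hM)
    (hasSpectralRadiusLE_of_isHermitian hN) hφ
  refine (le_abs_self _).trans (this.trans_eq ?_)
  ring

end Optimal

/-! ### Maximal rates of sums and in the presence of ancillas -/

theorem isGreatest_entanglementRates_boxSum {A₁ B₁ A₂ B₂ : Type*} [Fintype A₁] [Fintype B₁]
    [Fintype A₂] [Fintype B₂] [DecidableEq A₁] [DecidableEq B₁] [DecidableEq A₂] [DecidableEq B₂]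
    [Nonempty A₁] [Nonempty B₁] [Nonempty A₂] [Nonempty B₂]
    {P₁ : Matrix A₁ A₁ ℂ} {Q₁ : Matrix B₁ B₁ ℂ}
    {P₂ : Matrix A₂ A₂ ℂ} {Q₂ : Matrix B₂ B₂ ℂ} (hP₁ : P₁.IsHermitian) (hQ₁ : Q₁.IsHermitian)
    (hP₂ : P₂.IsHermitian) (hQ₂ : Q₂.IsHermitian) :
    IsGreatest (entanglementRates (boxSum (P₁ ⊗ₖ Q₁) (P₂ ⊗ₖ Q₂)))
      (entanglementCapability (P₁ ⊗ₖ Q₁) + entanglementCapability (P₂ ⊗ₖ Q₂)) := by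
  have g₁ := isGreatest_entanglementRates_kronecker hP₁ hQ₁
  have g₂ := isGreatest_entanglementRates_kronecker hP₂ hQ₂
  rw [entanglementCapability_eq_of_isGreatest g₁, entanglementCapability_eq_of_isGreatest g₂]
  obtain ⟨⟨ψ₁, hψ₁, e₁⟩, -⟩ := g₁
  obtain ⟨⟨ψ₂, hψ₂, e₂⟩, -⟩ := g₂
  refine ⟨⟨prodState ψ₁ ψ₂, isNormalized_prodState hψ₁ hψ₂, ?_⟩, ?_⟩
  · rw [entanglementRate_boxSum_prodState (isHermitian_kronecker hP₁ hQ₁)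
      (isHermitian_kronecker hP₂ hQ₂) hψ₁ hψ₂, e₁, e₂]
  · rintro _ ⟨φ, hφ, rfl⟩
    have := abs_entanglementRate_boxSum_le hP₁ hQ₁ hP₂ hQ₂
      (hasSpectralRadiusLE_of_isHermitian hP₁) (hasSpectralRadiusLE_of_isHermitian hQ₁)
      (hasSpectralRadiusLE_of_isHermitian hP₂) (hasSpectralRadiusLE_of_isHermitian hQ₂) hφ
    refine (le_abs_self _).trans (this.trans_eq ?_)
    ring

theorem isGreatest_entanglementRates_withAncillas {A B A' B' : Type*} [Fintype A] [Fintype B]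
    [Fintype A'] [Fintype B'] [DecidableEq A] [DecidableEq B] [DecidableEq A'] [DecidableEq B']
    [Nonempty A] [Nonempty B] [Nonempty A'] [Nonempty B'] {P : Matrix A A ℂ} {Q : Matrix B B ℂ}
    (hP : P.IsHermitian) (hQ : Q.IsHermitian) :
    IsGreatest (entanglementRates (withAncillas A' B' (P ⊗ₖ Q)))
      (entanglementCapability (P ⊗ₖ Q)) := by
  -- The ancillas form a second pair with Hamiltonian `0 ⊗ₖ 0`, whose capability is zero.
  have h := isGreatest_entanglementRates_boxSum hP hQ
    (Matrix.isHermitian_zero (n := A') (α := ℂ)) (Matrix.isHermitian_zero (n := B') (α := ℂ))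
  obtain ⟨φ, hφ⟩ := exists_isNormalized (ι := A' × B')
  have h0 : entanglementCapability (0 : Matrix (A' × B') (A' × B') ℂ) = 0 := by
    refine entanglementCapability_eq_of_isGreatest ⟨⟨φ, hφ, (entanglementRate_zero φ).symm⟩, ?_⟩
    rintro _ ⟨φ, -, rfl⟩
    exact (entanglementRate_zero φ).le
  rwa [Matrix.zero_kronecker, h0, add_zero, ← withAncillas_eq_boxSum] at h

end BipartiteEntanglement

end

/-! ### The main theorem -/

open BipartiteEntanglement in
theorem mainTheorem5 :
    -- the maximum that defines `α` is attained
    (∃ x₀ ∈ Set.Icc (0 : ℝ) 1, IsMaxOn isingRate (Set.Icc 0 1) x₀ ∧ alpha = isingRate x₀) ∧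
    -- entanglement rates exist
    (∀ (A B : Type*) [Fintype A] [DecidableEq A] [Fintype B] [DecidableEq B]
      (H : Matrix (A × B) (A × B) ℂ), H.IsHermitian →
      ∀ ψ : A × B → ℂ, IsNormalized ψ →
        DifferentiableAt ℝ (fun t : ℝ => entanglement (evolve H t ψ)) 0) ∧
    -- the capability of a product Hamiltonian, without and with ancillas, and an optimal state
    (∀ (A B : Type*) [Fintype A] [DecidableEq A] [Nonempty A]
      [Fintype B] [DecidableEq B] [Nonempty B]
      (HA : Matrix A A ℂ) (HB : Matrix B B ℂ) (hA : HA.IsHermitian) (hB : HB.IsHermitian),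
      entanglementCapability (HA ⊗ₖ HB) = alpha / 4 * spectralSpread hA * spectralSpread hB ∧
      IsGreatest (entanglementRates (HA ⊗ₖ HB)) (entanglementCapability (HA ⊗ₖ HB)) ∧
      (∀ (A' B' : Type*) [Fintype A'] [DecidableEq A'] [Nonempty A']
        [Fintype B'] [DecidableEq B'] [Nonempty B'],
        IsGreatest (entanglementRates (withAncillas A' B' (HA ⊗ₖ HB)))
          (entanglementCapability (HA ⊗ₖ HB))) ∧
      (∀ x₀ ∈ Set.Icc (0 : ℝ) 1, IsMaxOn isingRate (Set.Icc 0 1) x₀ →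
        ∀ (e f : A → ℂ) (e' f' : B → ℂ), IsExtremalPair hA e f → IsExtremalPair hB e' f' →
          IsNormalized (optimalInput x₀ e f e' f') ∧
          entanglementRate (HA ⊗ₖ HB) (optimalInput x₀ e f e' f') =
            entanglementCapability (HA ⊗ₖ HB))) ∧
    -- additivity for product Hamiltonians on different pairs of systems
    (∀ (A₁ B₁ A₂ B₂ : Type*) [Fintype A₁] [DecidableEq A₁] [Nonempty A₁]
      [Fintype B₁] [DecidableEq B₁] [Nonempty B₁] [Fintype A₂] [DecidableEq A₂] [Nonempty A₂]
      [Fintype B₂] [DecidableEq B₂] [Nonempty B₂]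
      (HA₁ : Matrix A₁ A₁ ℂ) (HB₁ : Matrix B₁ B₁ ℂ) (HA₂ : Matrix A₂ A₂ ℂ) (HB₂ : Matrix B₂ B₂ ℂ),
      HA₁.IsHermitian → HB₁.IsHermitian → HA₂.IsHermitian → HB₂.IsHermitian →
      entanglementCapability (boxSum (HA₁ ⊗ₖ HB₁) (HA₂ ⊗ₖ HB₂)) =
        entanglementCapability (HA₁ ⊗ₖ HB₁) + entanglementCapability (HA₂ ⊗ₖ HB₂) ∧
      IsGreatest (entanglementRates (boxSum (HA₁ ⊗ₖ HB₁) (HA₂ ⊗ₖ HB₂)))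
        (entanglementCapability (boxSum (HA₁ ⊗ₖ HB₁) (HA₂ ⊗ₖ HB₂)))) := by
  refine ⟨?_, ?_, ?_, ?_⟩
  · obtain ⟨x₀, hx₀, h⟩ := exists_isMaxOn_isingRate
    exact ⟨x₀, hx₀, h, alpha_eq_of_isMaxOn hx₀ h⟩
  · intro A B _ _ _ _ H hH ψ _
    exact differentiableAt_entanglement hH ψ
  · intro A B _ _ _ _ _ _ HA HB hA hB
    have h := isGreatest_entanglementRates_kronecker hA hB
    have hcap := entanglementCapability_eq_of_isGreatest h
    refine ⟨hcap, hcap ▸ h, ?_, ?_⟩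
    · intro A' B' _ _ _ _ _ _
      exact isGreatest_entanglementRates_withAncillas hA hB
    · intro x₀ hx₀ hmax e f e' f' hef hef'
      rw [hcap, alpha_eq_of_isMaxOn hx₀ hmax]
      exact hef.optimalInput_spec hef' hx₀
  · intro A₁ B₁ A₂ B₂ _ _ _ _ _ _ _ _ _ _ _ _ HA₁ HB₁ HA₂ HB₂ hA₁ hB₁ hA₂ hB₂
    have h := isGreatest_entanglementRates_boxSum hA₁ hB₁ hA₂ hB₂
    have hcap := entanglementCapability_eq_of_isGreatest h
    exact ⟨hcap, hcap ▸ h⟩
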